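/- For $n\ge 1$, an $n$-dimensional rectangle in $\mathbb{R}^n$ is a set $[a_1,b_1]\times\cdots\times[a_n,b_n]$ with $a_i<b_i$ for all $i$; its faces with normal vector $e_i$ are its two subsets given by $x_i=a_i$ and by $x_i=b_i$. A locally regulated partition of an $n$-dimensional rectangle $R$ is a finite set $\mathcal{P}$ of $n$-dimensional rectangles with pairwise disjoint interiors and $\bigcup\mathcal{P}=R$. It is minimal if for every $x$ in the interior of $R$ we have $\nu_{\mathcal{P}}(x)=\beta_{\mathcal{P}}(x)+1$, where $\nu_{\mathcal{P}}(x)$ is the number of elements of $\mathcal{P}$ containing $x$ and $\beta_{\mathcal{P}}(x)$ is the number of indices $i\in\{1,\dots,n\}$ such that $x$ lies in a face with normal vector $e_i$ of some element of $\mathcal{P}$. (1) For every $2$-dimensional rectangle $R$ in $\mathbb{R}^2$ and every finite set $\mathcal{S}$ of pairwise disjoint $2$-dimensional rectangles contained in $R$, there is a minimal locally regulated partition $\mathcal{P}$ of $R$ with $\mathcal{S}\subseteq\mathcal{P}$. (2) For every $n\ge 3$ and every $n$-dimensional rectangle $R$ in $\mathbb{R}^n$, there is a finite set $\mathcal{S}$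 of pairwise disjoint $n$-dimensional rectangles contained in $R$ such that no minimal locally regulated partition $\mathcal{P}$ of $R$ satisfies $\mathcal{S}\subseteq\mathcal{P}$. (3) For $n=3$ and $R=[0,4]^3$, the set $\mathcal{S}$ consisting of the three pairwise disjoint blocks $[0,3]\times[0,2]\times[0,1]$, $[2,4]\times[3,4]\times[0,3]$ and $[0,1]\times[1,4]\times[2,4]$ has the property in (2). -/

import Mathlib

/-- An `n`-dimensional rectangle of `ℝⁿ`: a product `∏ i, [a i, b i]` of nondegenerate compact
intervals. The order on `Fin n → ℝ` is coordinatewise, so `Set.Icc a b` is that product. -/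
def IsRectangle {n : ℕ} (R : Set (Fin n → ℝ)) : Prop :=
  ∃ a b : Fin n → ℝ, (∀ i, a i < b i) ∧ R = Set.Icc a b

/-- `F` is a face of the rectangle `P` with normal vector `e_i`. -/
def IsFaceWithNormal {n : ℕ} (P : Set (Fin n → ℝ)) (i : Fin n) (F : Set (Fin n → ℝ)) : Prop :=
  ∃ a b : Fin n → ℝ, (∀ j, a j < b j) ∧ P = Set.Icc a b ∧
    (F = {x ∈ P | x i = a i} ∨ F = {x ∈ P | x i = b i})

/-- A locally regulated partition of `R`: a finite set of `n`-dimensional rectangles whose union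
is `R` and whose interiors are pairwise disjoint. -/
structure IsLocallyRegulatedPartition {n : ℕ} (R : Set (Fin n → ℝ))
    (P : Set (Set (Fin n → ℝ))) : Prop where
  finite : P.Finite
  isRectangle : ∀ Q ∈ P, IsRectangle Q
  sUnion_eq : ⋃₀ P = R
  disjoint_interior : ∀ Q₁ ∈ P, ∀ Q₂ ∈ P, Q₁ ≠ Q₂ → interior Q₁ ∩ interior Q₂ = ∅

/-- The standard unit vector `e_i` is a boundary vector of `x` with respect to `P`. -/
def IsBoundaryVector {n : ℕ} (P : Set (Set (Fin n → ℝ))) (x : Fin n → ℝ) (i : Fin n) : Prop :=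
  ∃ Q ∈ P, ∃ F, IsFaceWithNormal Q i F ∧ x ∈ F

/-- The boundary rank of `x`: the number of its boundary vectors. -/
noncomputable def boundaryRank {n : ℕ} (P : Set (Set (Fin n → ℝ))) (x : Fin n → ℝ) : ℕ :=
  {i : Fin n | IsBoundaryVector P x i}.ncard

/-- The partition number of `x`: the number of members of `P` containing `x` (only used for
finite `P`). -/
noncomputable def partitionNumber {n : ℕ} (P : Set (Set (Fin n → ℝ))) (x : Fin n → ℝ) : ℕ :=
  {Q ∈ P | x ∈ Q}.ncard

/-- A locally regulated partition of `R` is minimal if the partition number equals the boundary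
rank plus one at every interior point of `R`. -/
structure IsMinimalLocallyRegulatedPartition {n : ℕ} (R : Set (Fin n → ℝ))
    (P : Set (Set (Fin n → ℝ))) : Prop extends IsLocallyRegulatedPartition R P where
  minimal : ∀ x ∈ interior R, partitionNumber P x = boundaryRank P x + 1

/-- A finite set of pairwise disjoint `n`-dimensional subrectangles of `R`. -/
structure IsDisjointSubrectangles {n : ℕ} (R : Set (Fin n → ℝ))
    (S : Set (Set (Fin n → ℝ))) : Prop where
  finite : S.Finite
  isRectangle : ∀ Q ∈ S, IsRectangle Q
  subset : ∀ Q ∈ S, Q ⊆ R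
  disjoint : ∀ Q₁ ∈ S, ∀ Q₂ ∈ S, Q₁ ≠ Q₂ → Q₁ ∩ Q₂ = ∅

/-- The cube `[0,4]³`. -/
def cubeR : Set (Fin 3 → ℝ) := Set.Icc ![0, 0, 0] ![4, 4, 4]

/-- The three blocks `[0,3]×[0,2]×[0,1]`, `[2,4]×[3,4]×[0,3]`, `[0,1]×[1,4]×[2,4]`. -/
def cubeBlocks : Set (Set (Fin 3 → ℝ)) :=
  {Set.Icc ![0, 0, 0] ![3, 2, 1], Set.Icc ![2, 3, 0] ![4, 4, 3], Set.Icc ![0, 1, 2] ![1, 4, 4]}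

/-! ### Discrete model: box labellings and their walls -/

/-- `z` lies in the box spanned by `p` and `q`. -/
def IsBetween {ι β : Type*} [LE β] (p q z : ι → β) : Prop :=
  ∀ t, p t ≤ z t ∧ z t ≤ q t ∨ q t ≤ z t ∧ z t ≤ p t

/-- A labelling of the cells of `ℤ^ι`, constant outside the box `[0, M]`, whose label classes are
boxes, and such that the cells around a common corner in the directions `J` carry at most
`J.card + 1` labels. -/
structure IsBoxLabeling {ι α : Type*} [DecidableEq ι] (M : ι → ℤ) (L : (ι → ℤ) → α) : Prop where
  nonneg : 0 ≤ M
  box : ∀ p q r, L p = L q → IsBetween p q r → L r = L p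
  below : ∀ p i, p i < 0 → L (p + Pi.single i 1) = L p
  above : ∀ p i, M i ≤ p i → L (p + Pi.single i 1) = L p
  few : ∀ (p : ι → ℤ) (J : Finset ι) (T : Finset α),
    (∀ τ ∈ T, ∃ q : ι → ℤ, (∀ t, p t ≤ q t ∧ q t ≤ p t + if t ∈ J then 1 else 0) ∧ L q = τ) →
      T.card ≤ J.card + 1

/-- The cells `p` and `p + e_i` have different labels. -/
def IsWall {ι α : Type*} [DecidableEq ι] (L : (ι → ℤ) → α) (i : ι) (p : ι → ℤ) : Prop :=
  L p ≠ L (p + Pi.single i 1)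

/-- `r` and `q` lie on the same wall with normal `e_i`. -/
def WallRel {ι α : Type*} [DecidableEq ι] (L : (ι → ℤ) → α) (i : ι) (r q : ι → ℤ) : Prop :=
  r i = q i ∧ ∀ z, IsBetween r q z → IsWall L i z

/-- A set of labels which contains all labels below a wall as soon as it contains one above it. -/
def IsWallClosed {ι α : Type*} [DecidableEq ι] (M : ι → ℤ) (L : (ι → ℤ) → α) (D : Set α) : Prop :=
  ∀ i, ∀ r ∈ Set.Icc 0 M, ∀ r' ∈ Set.Icc 0 M, WallRel L i r r' → L (r' + Pi.single i 1) ∈ D → L r ∈ D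

/-- `τ` is the label below the top corner of a wall, and `τ'` the label above its bottom corner. -/
def IsSuccLabel {ι α : Type*} [DecidableEq ι] (M : ι → ℤ) (L : (ι → ℤ) → α) (τ τ' : α) : Prop :=
  ∃ i m b, m ∈ Set.Icc 0 M ∧ L m = τ ∧
    (∀ k, k ≠ i → m k < M k → ¬ IsWall L i (m + Pi.single k 1)) ∧
    b ∈ Set.Icc 0 M ∧ WallRel L i b m ∧
    (∀ k, k ≠ i → 0 < b k → ¬ IsWall L i (b + Pi.single k (-1))) ∧ L (b + Pi.single i 1) = τ'

theorem five_le_card {α : Type*} {a b c d e : α} {T : Finset α}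
    (hab : a ≠ b) (hac : a ≠ c) (had : a ≠ d) (hae : a ≠ e) (hbc : b ≠ c) (hbd : b ≠ d)
    (hbe : b ≠ e) (hcd : c ≠ d) (hce : c ≠ e) (hde : d ≠ e)
    (hT : ∀ x, x = a ∨ x = b ∨ x = c ∨ x = d ∨ x = e → x ∈ T) : 5 ≤ T.card := by
  classical
  have : ({a, b, c, d, e} : Finset α).card = 5 := by
    simp [*]
  rw [← this]
  apply Finset.card_le_card
  intro x hx
  simp only [Finset.mem_insert, Finset.mem_singleton] at hx
  exact hT x hx

theorem IsBetween.symm {ι β : Type*} [LE β] {p q z : ι → β} (h : IsBetween p q z) :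
    IsBetween q p z := fun t => (h t).symm

theorem WallRel.symm {ι α : Type*} [DecidableEq ι] {L : (ι → ℤ) → α} {i : ι} {r q : ι → ℤ}
    (h : WallRel L i r q) : WallRel L i q r := ⟨h.1.symm, fun z hz => h.2 z hz.symm⟩

theorem WallRel.refl {ι α : Type*} [DecidableEq ι] {L : (ι → ℤ) → α} {i : ι} {r : ι → ℤ}
    (h : IsWall L i r) : WallRel L i r r := by
  refine ⟨rfl, fun z hz => ?_⟩
  have : z = r := by
    funext t
    rcases hz t with h | h <;> omega
  exact this ▸ h

theorem WallRel.left {ι α : Type*} [DecidableEq ι] {L : (ι → ℤ) → α} {i : ι} {r q : ι → ℤ}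
    (h : WallRel L i r q) : IsWall L i r :=
  h.2 r fun t => by omega

theorem WallRel.right {ι α : Type*} [DecidableEq ι] {L : (ι → ℤ) → α} {i : ι} {r q : ι → ℤ}
    (h : WallRel L i r q) : IsWall L i q := h.symm.left

/-- Distinct cells admit a unit step from the first towards the second. -/
theorem exists_unit_step {ι : Type*} [DecidableEq ι] [Fintype ι] {p q : ι → ℤ} (h : p ≠ q) :
    ∃ k, ∃ η : ℤ, (η = 1 ∨ η = -1) ∧ p k ≠ q k ∧ IsBetween p q (p + Pi.single k η) ∧
      ∑ t, (q t - (p + Pi.single k η : ι → ℤ) t).natAbs < ∑ t, (q t - p t).natAbs := by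
  obtain ⟨k, hk⟩ := Function.ne_iff.1 h
  refine ⟨k, if p k < q k then 1 else -1, by split_ifs <;> simp, hk, ?_, ?_⟩
  · intro t
    simp only [Pi.add_apply, Pi.single_apply]
    split_ifs with h1 h2 <;> (try subst h1) <;> omega
  · apply Finset.sum_lt_sum
    · intro t _
      simp only [Pi.add_apply, Pi.single_apply]
      split_ifs with h1 h2 <;> (try subst h1) <;> omega
    · refine ⟨k, Finset.mem_univ _, ?_⟩
      simp only [Pi.add_apply, Pi.single_eq_same]
      split_ifs with h1 <;> omega

/-! ### Walls of a box labelling are boxes -/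

namespace IsBoxLabeling

variable {ι α : Type*} [DecidableEq ι] {M : ι → ℤ} {L : (ι → ℤ) → α}

theorem isWall_bounds (hL : IsBoxLabeling M L) {i : ι} {p : ι → ℤ} (h : IsWall L i p) :
    0 ≤ p i ∧ p i < M i := by
  constructor
  · by_contra hc
    exact h (hL.below p i (by omega)).symm
  · by_contra hc
    exact h (hL.above p i (by omega)).symm

theorem add_single_mem (hL : IsBoxLabeling M L) {i : ι} {p : ι → ℤ} (h : IsWall L i p)
    (hp : p ∈ Set.Icc 0 M) : p + Pi.single i 1 ∈ Set.Icc 0 M := by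
  have hb := hL.isWall_bounds h
  constructor <;> intro t <;> have h1 := hp.1 t <;> have h2 := hp.2 t <;>
    simp only [Pi.add_apply, Pi.single_apply, Pi.zero_apply] at * <;> split_ifs with h3 <;>
    (try subst h3) <;> omega

/-- A wall has no reentrant corner. If `f` and the cell above it shared a label, that label and the
two pairs of labels across the neighbouring walls would be five distinct labels around a corner with
three directions, where `few` allows four. -/
theorem isWall_of_isWall_of_isWall (hL : IsBoxLabeling M L) {i k l : ι} (hk : k ≠ i) (hl : l ≠ i)
    (hkl : k ≠ l) {η ζ : ℤ} (hη : η = 1 ∨ η = -1) (hζ : ζ = 1 ∨ ζ = -1) {f : ι → ℤ}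
    (h1 : IsWall L i (f + Pi.single k η)) (h2 : IsWall L i (f + Pi.single l ζ)) :
    IsWall L i f := by
  classical
  intro h0
  have kb : L (f + Pi.single k η) ≠ L f := fun h => h1 <| by
    refine (hL.box (f + Pi.single k η) (f + Pi.single i 1) _ (h.trans h0) fun t => ?_).symm
    simp only [Pi.add_apply, Pi.single_apply]; grind
  have kb' : L (f + Pi.single k η + Pi.single i 1) ≠ L f := fun h => kb <| by
    rw [← h]
    refine (hL.box (f + Pi.single k η + Pi.single i 1) f _ h fun t => ?_)
    simp only [Pi.add_apply, Pi.single_apply]; grind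
  have kc : L (f + Pi.single l ζ) ≠ L f := fun h => h2 <| by
    refine (hL.box (f + Pi.single l ζ) (f + Pi.single i 1) _ (h.trans h0) fun t => ?_).symm
    simp only [Pi.add_apply, Pi.single_apply]; grind
  have kc' : L (f + Pi.single l ζ + Pi.single i 1) ≠ L f := fun h => kc <| by
    rw [← h]
    refine (hL.box (f + Pi.single l ζ + Pi.single i 1) f _ h fun t => ?_)
    simp only [Pi.add_apply, Pi.single_apply]; grind
  have bc : L (f + Pi.single k η) ≠ L (f + Pi.single l ζ) := fun h => kb <| by
    refine (hL.box _ _ f h fun t => ?_).symm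
    simp only [Pi.add_apply, Pi.single_apply]; grind
  have bc' : L (f + Pi.single k η) ≠ L (f + Pi.single l ζ + Pi.single i 1) := fun h => kb <| by
    refine (hL.box _ _ f h fun t => ?_).symm
    simp only [Pi.add_apply, Pi.single_apply]; grind
  have cb' : L (f + Pi.single l ζ) ≠ L (f + Pi.single k η + Pi.single i 1) := fun h => kc <| by
    refine (hL.box _ _ f h fun t => ?_).symm
    simp only [Pi.add_apply, Pi.single_apply]; grind
  have bc'' : L (f + Pi.single k η + Pi.single i 1) ≠ L (f + Pi.single l ζ + Pi.single i 1) :=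
    fun h => kb' <| by
    rw [h0]
    refine (hL.box _ _ _ h fun t => ?_).symm
    simp only [Pi.add_apply, Pi.single_apply]; grind
  -- The terms `min η 0` and `min ζ 0` move to the lowest cell of the cube, whatever the signs of
  -- the two steps.
  have hcard := hL.few (f + Pi.single k (min η 0) + Pi.single l (min ζ 0)) {i, k, l}
    {L f, L (f + Pi.single k η), L (f + Pi.single k η + Pi.single i 1), L (f + Pi.single l ζ),
      L (f + Pi.single l ζ + Pi.single i 1)} (by
    intro τ hτ
    simp only [Finset.mem_insert, Finset.mem_singleton] at hτ
    rcases hτ with rfl | rfl | rfl | rfl | rfl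
    all_goals
      refine ⟨_, fun t => ?_, rfl⟩
      simp only [Pi.add_apply, Pi.single_apply, Finset.mem_insert, Finset.mem_singleton]
      grind)
  have h5 := five_le_card kb.symm kb'.symm kc.symm kc'.symm h1 bc bc' cb'.symm bc'' h2
    (T := {L f, L (f + Pi.single k η), L (f + Pi.single k η + Pi.single i 1), L (f + Pi.single l ζ),
      L (f + Pi.single l ζ + Pi.single i 1)}) (by simp)
  have h3 : ({i, k, l} : Finset ι).card ≤ 3 := Finset.card_le_three
  omega

variable [Fintype ι]

/-- One new wall cell next to `q` forces the whole adjacent layer of the box to be wall: wallhood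
spreads from it through the layer, since each further cell sits in a corner between the known box
and a cell already reached. -/
theorem wallRel_add_single (hL : IsBoxLabeling M L) {i k : ι} (hk : k ≠ i) {η : ℤ}
    (hη : η = 1 ∨ η = -1) {r q : ι → ℤ} (h : WallRel L i r q)
    (hw : IsWall L i (q + Pi.single k η)) : WallRel L i r (q + Pi.single k η) := by
  refine ⟨by simp [hk.symm, h.1], ?_⟩
  have key : ∀ N : ℕ, ∀ y, ∑ t, (q t - y t).natAbs = N → IsBetween r q y → y k = q k →
      IsWall L i (y + Pi.single k η) := by
    intro N
    induction N using Nat.strong_induction_on with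
    | _ N ih =>
      intro y hN hy hyk
      by_cases hyq : y = q
      · exact hyq ▸ hw
      obtain ⟨l, ζ, hζ, hl, hb, hlt⟩ := exists_unit_step hyq
      have hlk : l ≠ k := by rintro rfl; exact hl hyk
      have hli : l ≠ i := by
        rintro rfl
        have := hy l
        have := h.1
        omega
      subst hN
      have h1 := ih _ hlt (y + Pi.single l ζ) rfl
        (fun t => by have := hy t; have := hb t; omega) (by simp [hlk.symm, hyk])
      have h2 := h.2 y hy
      refine hL.isWall_of_isWall_of_isWall hk hli hlk.symm (η := -η) (by omega) hζ ?_ ?_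
      · convert h2 using 1
        rw [add_assoc, ← Pi.single_add]; simp
      · rwa [add_right_comm]
  intro z hz
  by_cases hzk : IsBetween r q z
  · exact h.2 z hzk
  have hzk' : z k = q k + η ∧ IsBetween r q (z + Pi.single k (-η)) := by
    simp only [IsBetween, not_forall] at hzk
    obtain ⟨t, ht⟩ := hzk
    have hzt := hz t
    simp only [Pi.add_apply, Pi.single_apply] at hzt
    split_ifs at hzt with h1
    · subst h1
      refine ⟨by omega, fun s => ?_⟩
      have := hz s
      simp only [Pi.add_apply, Pi.single_apply] at this ⊢
      split_ifs at this ⊢ with h2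
      · subst h2; omega
      · omega
    · omega
  have := key _ (z + Pi.single k (-η)) rfl hzk'.2 (by simp; omega)
  rwa [add_assoc, ← Pi.single_add, neg_add_cancel, Pi.single_zero, add_zero] at this

/-- Walking from `q` to `s` inside their common box, each unit step enlarges the box spanned from
`r`. -/
theorem wallRel_trans (hL : IsBoxLabeling M L) {i : ι} {r q s : ι → ℤ} (h1 : WallRel L i r q)
    (h2 : WallRel L i q s) : WallRel L i r s := by
  induction hN : ∑ t, (s t - q t).natAbs using Nat.strong_induction_on generalizing q with
  | _ N ih =>
    by_cases hqs : q = s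
    · exact hqs ▸ h1
    obtain ⟨k, η, hη, hk, hb, hlt⟩ := exists_unit_step hqs
    have hki : k ≠ i := by rintro rfl; exact hk h2.1
    subst hN
    refine ih _ hlt (hL.wallRel_add_single hki hη h1 (h2.2 _ hb)) ⟨?_, fun z hz => ?_⟩ rfl
    · simp [hki.symm, h2.1]
    · exact h2.2 z fun t => by have := hz t; have := hb t; omega

end IsBoxLabeling

/-! ### Wall-closed sets of labels and the successor of a label -/

/-- On a descending path of unit steps from `q` to `p`, each step either keeps the label or crosses
a wall downwards, and wall-closedness covers the crossing. -/
theorem IsWallClosed.mem_of_le {ι α : Type*} [DecidableEq ι] [Fintype ι] {M : ι → ℤ}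
    {L : (ι → ℤ) → α} {D : Set α} (hD : IsWallClosed M L D) {p q : ι → ℤ} (hp : 0 ≤ p)
    (hq : q ≤ M) (hpq : p ≤ q) (h : L q ∈ D) : L p ∈ D := by
  induction hN : ∑ t, (p t - q t).natAbs using Nat.strong_induction_on generalizing q with
  | _ N ih =>
    by_cases hqp : q = p
    · exact hqp ▸ h
    obtain ⟨k, η, hη, hk, hb, hlt⟩ := exists_unit_step hqp
    have hle : ∀ t, p t ≤ (q + Pi.single k η : ι → ℤ) t ∧ (q + Pi.single k η : ι → ℤ) t ≤ q t := fun t => by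
      have := hb t; have : p t ≤ q t := hpq t; omega
    have hη1 : η = -1 := by have := hle k; simp at this; omega
    subst hη1
    have hq' : q + Pi.single k (-1) ≤ M := fun t => (hle t).2.trans (hq t)
    subst hN
    refine ih _ hlt hq' (fun t => (hle t).1) ?_ rfl
    have e : q + Pi.single k (-1) + Pi.single k 1 = q := by
      rw [add_assoc, ← Pi.single_add]; simp
    by_cases hw : IsWall L k (q + Pi.single k (-1))
    · have hm : q + Pi.single k (-1) ∈ Set.Icc 0 M :=
        ⟨fun t => (hp t).trans (hle t).1, hq'⟩
      exact hD k _ hm _ hm (WallRel.refl hw) (e.symm ▸ h)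
    · rw [IsWall, not_not] at hw
      rw [hw, e]
      exact h

namespace IsBoxLabeling

variable {ι α : Type*} [DecidableEq ι] {M : ι → ℤ} {L : (ι → ℤ) → α}

theorem le_of_wallRel_top {i : ι} {m r : ι → ℤ}
    (hm : ∀ k, k ≠ i → m k < M k → ¬ IsWall L i (m + Pi.single k 1)) (hr : r ≤ M)
    (h : WallRel L i r m) : r ≤ m := by
  refine fun k => not_lt.1 fun (hk : m k < r k) => ?_
  have hki : k ≠ i := by rintro rfl; exact hk.ne' h.1
  refine hm k hki (hk.trans_le (hr k)) (h.2 _ fun t => ?_)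
  simp only [Pi.add_apply, Pi.single_apply]
  split_ifs with h1
  · subst h1; omega
  · omega

/-- The cell above the bottom corner of a wall is the bottom cell of its label class. -/
theorem bottom_le (hL : IsBoxLabeling M L) {i : ι} {b c : ι → ℤ} (hw : IsWall L i b)
    (hb : ∀ k, k ≠ i → 0 < b k → ¬ IsWall L i (b + Pi.single k (-1))) (hc : 0 ≤ c)
    (h : L c = L (b + Pi.single i 1)) : b + Pi.single i 1 ≤ c := by
  have box := fun x hx => hL.box c (b + Pi.single i 1) x h hx
  refine fun k => not_lt.1 fun (hk : c k < (b + Pi.single i 1 : ι → ℤ) k) => ?_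
  simp only [Pi.add_apply, Pi.single_apply] at hk
  by_cases hki : k = i
  · subst hki
    refine hw ((box b fun t => ?_).trans h)
    simp only [Pi.add_apply, Pi.single_apply]
    grind
  · rw [if_neg hki] at hk
    have h1 : L (b + Pi.single k (-1) + Pi.single i 1) = L c := box _ fun t => by
      simp only [Pi.add_apply, Pi.single_apply]; grind
    have h2 := hb k hki (by have : 0 ≤ c k := hc k; omega)
    rw [IsWall, not_not, h1, h] at h2
    refine hw ((hL.box _ _ b h2 fun t => ?_).trans h2)
    simp only [Pi.add_apply, Pi.single_apply]; grind

/-- The wall stops below `b` in direction `j`, so the two cells just beyond its edge share one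
label. Neither `b` nor the cell above it can carry that label, since convexity would then remove the
wall at `b`; hence a single wall with normal `e_j` passes under both. -/
theorem isWall_down (hL : IsBoxLabeling M L) {i : ι} {b : ι → ℤ} (hw : IsWall L i b)
    (hb : ∀ k, k ≠ i → 0 < b k → ¬ IsWall L i (b + Pi.single k (-1))) {j : ι} (hj : j ≠ i)
    (hbj : 0 < b j) : IsWall L j (b + Pi.single j (-1)) ∧
      IsWall L j (b + Pi.single i 1 + Pi.single j (-1)) ∧
      WallRel L j (b + Pi.single i 1 + Pi.single j (-1)) (b + Pi.single j (-1)) := by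
  have e1 : b + Pi.single j (-1) + Pi.single j 1 = b := by
    rw [add_assoc, ← Pi.single_add]; simp
  have e2 : b + Pi.single i 1 + Pi.single j (-1) + Pi.single j 1 = b + Pi.single i 1 := by
    rw [add_assoc, ← Pi.single_add]; simp
  have h2 := hb j hj hbj
  rw [IsWall, not_not, add_right_comm] at h2
  have w1 : IsWall L j (b + Pi.single j (-1)) := by
    intro h
    rw [e1] at h
    refine hw (hL.box _ _ _ (h.symm.trans h2) fun t => ?_).symm
    simp only [Pi.add_apply, Pi.single_apply]; grind
  have w2 : IsWall L j (b + Pi.single i 1 + Pi.single j (-1)) := by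
    intro h
    rw [e2] at h
    have h3 := h2.trans h
    refine hw ((hL.box _ _ b h3 fun t => ?_).trans h3)
    simp only [Pi.add_apply, Pi.single_apply]; grind
  refine ⟨w1, w2, by simp [hj], fun z hz => ?_⟩
  by_cases hzi : z i = b i
  · have : z = b + Pi.single j (-1) := by
      funext t
      have := hz t
      simp only [Pi.add_apply, Pi.single_apply] at this ⊢
      grind
    exact this ▸ w1
  · have : z = b + Pi.single i 1 + Pi.single j (-1) := by
      funext t
      have := hz t
      simp only [Pi.add_apply, Pi.single_apply] at this ⊢
      grind
    exact this ▸ w2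

/-- Adding the label above the bottom corner of a wall keeps a set of labels wall closed. -/
theorem isWallClosed_insert [Fintype ι] (hL : IsBoxLabeling M L) {D : Set α} {τ τ' : α}
    (hD : IsWallClosed M L D) (hτ : τ ∈ D) (h : IsSuccLabel M L τ τ') :
    IsWallClosed M L (insert τ' D) := by
  obtain ⟨i, m, b, hm, rfl, htop, hbM, hbm, hbot, rfl⟩ := h
  have hbm' := le_of_wallRel_top htop hbM.2 hbm
  have hlow : ∀ r ∈ Set.Icc 0 M, r ≤ m → L r ∈ D := fun r hr hrm =>
    hD.mem_of_le hr.1 hm.2 hrm hτ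
  intro j r hr r' hr' hrr' hmem
  by_cases hV : L (r' + Pi.single j 1) ∈ D
  · exact Or.inr (hD j r hr r' hr' hrr' hV)
  refine Or.inr ?_
  have hV' : L (r' + Pi.single j 1) = L (b + Pi.single i 1) := hmem.resolve_right hV
  have hq := hL.bottom_le hbm.left hbot (hL.add_single_mem hrr'.right hr').1 hV'
  -- The cell above `r'` lies in the lowest layer of the new box in direction `j`; otherwise `r'`
  -- would belong to the box and there would be no wall.
  have hcj : (r' + Pi.single j 1 : ι → ℤ) j = (b + Pi.single i 1 : ι → ℤ) j := by
    by_contra hne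
    have hlt := lt_of_le_of_ne (hq j) (Ne.symm hne)
    refine hrr'.right (hL.box _ _ r' hV' fun t => ?_)
    have := hq t
    simp only [Pi.add_apply, Pi.single_apply] at this hlt ⊢
    grind
  have hin : ∀ z, IsBetween r' (b + Pi.single i 1 + Pi.single j (-1)) z →
      L (z + Pi.single j 1) = L (b + Pi.single i 1) := fun z hz => by
    refine (hL.box _ _ _ hV' fun t => ?_).trans hV'
    have := hz t
    simp only [Pi.add_apply, Pi.single_apply] at this hcj ⊢
    grind
  have hout : ∀ z, IsBetween r' (b + Pi.single i 1 + Pi.single j (-1)) z →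
      L (b + Pi.single i 1 + Pi.single j (-1)) ≠ L (b + Pi.single i 1) →
      L z ≠ L (b + Pi.single i 1) := fun z hz hne h => by
    refine hne ((hL.box _ _ _ h fun t => ?_).trans h)
    have := hz t
    have := hq t
    simp only [Pi.add_apply, Pi.single_apply] at *
    grind
  have hrel : L (b + Pi.single i 1 + Pi.single j (-1)) ≠ L (b + Pi.single i 1) →
      WallRel L j r' (b + Pi.single i 1 + Pi.single j (-1)) := fun hne =>
    ⟨by simp at hcj ⊢; omega, fun z hz h => hout z hz hne (h.trans (hin z hz))⟩
  -- For `j = i` the lower facet of the new box lies on the defining wall, all of whose cells are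
  -- below `m`. For `j ≠ i` it lies on a wall that also passes under `b`; the label of `b` is in
  -- `D`, so closedness of `D` already applies.
  by_cases hji : j = i
  · subst hji
    have e : b + Pi.single j 1 + Pi.single j (-1) = b := by
      rw [add_assoc, ← Pi.single_add]; simp
    rw [e] at hrel
    have := hL.wallRel_trans hrr' (hL.wallRel_trans (hrel hbm.left) hbm)
    exact hlow r hr (le_of_wallRel_top htop hr.2 this)
  · have hbj : 0 < b j := by
      have : 0 ≤ r' j := hr'.1 j
      simp [hji] at hcj
      omega
    obtain ⟨w1, w2, hww⟩ := hL.isWall_down hbm.left hbot hji hbj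
    have e1 : b + Pi.single j (-1) + Pi.single j 1 = b := by
      rw [add_assoc, ← Pi.single_add]; simp
    have e2 : b + Pi.single i 1 + Pi.single j (-1) + Pi.single j 1 = b + Pi.single i 1 := by
      rw [add_assoc, ← Pi.single_add]; simp
    have hrel' := hrel (by rw [IsWall, e2] at w2; exact w2)
    refine hD j r hr (b + Pi.single j (-1)) ?_
      (hL.wallRel_trans hrr' (hL.wallRel_trans hrel' hww)) (by rw [e1]; exact hlow b hbM hbm')
    constructor <;> intro t <;> have h1 := hbM.1 t <;> have h2 := hbM.2 t <;>
      simp only [Pi.add_apply, Pi.single_apply, Pi.zero_apply] at * <;> grind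

theorem isWallClosed_singleton (hL : IsBoxLabeling M L) : IsWallClosed M L {L 0} := by
  intro i r hr r' hr' h hmem
  refine absurd ?_ h.right
  have hmem : L 0 = L (r' + Pi.single i 1) := (Set.mem_singleton_iff.1 hmem).symm
  refine (hL.box _ _ r' hmem fun t => ?_).trans hmem
  have : 0 ≤ r' t := hr'.1 t
  simp only [Pi.add_apply, Pi.single_apply, Pi.zero_apply]
  grind

theorem isSuccLabel_ne (hL : IsBoxLabeling M L) {τ τ' : α} (h : IsSuccLabel M L τ τ') :
    τ' ≠ L 0 := by
  obtain ⟨i, m, b, hm, rfl, htop, hbM, hbm, hbot, rfl⟩ := h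
  intro h
  refine hbm.left ((hL.box _ _ b h.symm fun t => ?_).trans h.symm)
  have : 0 ≤ b t := hbM.1 t
  simp only [Pi.add_apply, Pi.single_apply, Pi.zero_apply]
  grind

theorem isSuccLabel_mem (hL : IsBoxLabeling M L) {τ τ' : α} (h : IsSuccLabel M L τ τ') :
    τ' ∈ L '' Set.Icc 0 M := by
  obtain ⟨i, m, b, hm, rfl, htop, hbM, hbm, hbot, rfl⟩ := h
  exact ⟨_, hL.add_single_mem hbm.left hbM, rfl⟩

/-- The label `τ'` determines its bottom cell. With equal normals this fixes the wall and hence its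
top corner. With different normals, both walls end at the common lower cell of a square, so `b` and
`b'` share a label; convexity then gives it to the bottom cell of `τ'` as well, contradicting the
wall. -/
theorem isSuccLabel_injective [Fintype ι] (hL : IsBoxLabeling M L) {τ₁ τ₂ τ' : α}
    (h₁ : IsSuccLabel M L τ₁ τ') (h₂ : IsSuccLabel M L τ₂ τ') : τ₁ = τ₂ := by
  obtain ⟨i, m, b, hm, rfl, htop, hbM, hbm, hbot, rfl⟩ := h₁
  obtain ⟨i', m', b', hm', rfl, htop', hbM', hbm', hbot', h⟩ := h₂
  have e := le_antisymm
    (hL.bottom_le hbm.left hbot (hL.add_single_mem hbm'.left hbM').1 h)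
    (hL.bottom_le hbm'.left hbot' (hL.add_single_mem hbm.left hbM).1 h.symm)
  by_cases hii : i' = i
  · subst hii
    obtain rfl := add_right_cancel e
    have hmm := hL.wallRel_trans hbm.symm hbm'
    rw [le_antisymm (le_of_wallRel_top htop' hm.2 hmm) (le_of_wallRel_top htop hm'.2 hmm.symm)]
  · exfalso
    have ei := congrFun e i
    have ei' := congrFun e i'
    have p1 : 0 ≤ b i := hbM.1 i
    have p2 : 0 ≤ b' i' := hbM'.1 i'
    simp only [Pi.add_apply, Pi.single_apply, if_pos, if_neg hii, if_neg (Ne.symm hii)] at ei ei'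
    have hc : b + Pi.single i' (-1) = b' + Pi.single i (-1) := by
      have h1 : b = b' + Pi.single i' 1 - Pi.single i 1 := eq_sub_of_add_eq e
      rw [h1, Pi.single_neg, Pi.single_neg]
      abel
    have h1 := hbot i' hii (by omega)
    have h2 := hbot' i (Ne.symm hii) (by omega)
    rw [IsWall, not_not] at h1 h2
    have e1 : b + Pi.single i' (-1) + Pi.single i 1 = b' := by
      rw [hc, add_assoc, ← Pi.single_add]; simp
    have e2 : b' + Pi.single i (-1) + Pi.single i' 1 = b := by
      rw [← hc, add_assoc, ← Pi.single_add]; simp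
    rw [e1] at h1
    rw [e2, ← hc] at h2
    refine hbm.left (hL.box b b' _ (h2.symm.trans h1) fun t => ?_).symm
    have := congrFun e t
    simp only [Pi.add_apply, Pi.single_apply] at this ⊢
    grind

end IsBoxLabeling

/-! ### Walls at a top corner and the linear order of the labels -/

namespace IsBoxLabeling

variable {ι α : Type*} [DecidableEq ι] {M : ι → ℤ} {L : (ι → ℤ) → α}

/-- At a top corner of a label class one of two walls stops. -/
theorem not_isWall_or (hL : IsBoxLabeling M L) {p : ι → ℤ} {i j : ι} (hij : i ≠ j)
    (hi : IsWall L i p) (hj : IsWall L j p) :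
    ¬ IsWall L j (p + Pi.single i 1) ∨ ¬ IsWall L i (p + Pi.single j 1) := by
  classical
  by_contra! h
  obtain ⟨h1, h2⟩ := h
  rw [IsWall] at hi hj h1 h2
  rw [add_right_comm] at h2
  have h3 : L (p + Pi.single i 1) ≠ L (p + Pi.single j 1) := fun h => hi <| by
    refine hL.box _ _ p h fun t => ?_
    simp only [Pi.add_apply, Pi.single_apply]; grind
  have h4 : L p ≠ L (p + Pi.single i 1 + Pi.single j 1) := fun h => hi <| by
    refine (hL.box _ _ _ h fun t => ?_).symm
    simp only [Pi.add_apply, Pi.single_apply]; grind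
  have := hL.few p {i, j} {L p, L (p + Pi.single i 1), L (p + Pi.single j 1),
    L (p + Pi.single i 1 + Pi.single j 1)} (by
    intro τ hτ
    simp only [Finset.mem_insert, Finset.mem_singleton] at hτ
    rcases hτ with rfl | rfl | rfl | rfl
    · exact ⟨_, fun t => by grind, rfl⟩
    all_goals
      refine ⟨_, fun t => ?_, rfl⟩
      simp only [Pi.add_apply, Pi.single_apply, Finset.mem_insert, Finset.mem_singleton]
      grind)
  have h5 : ({i, j} : Finset ι).card ≤ 2 := Finset.card_le_two
  have h6 : ({L p, L (p + Pi.single i 1), L (p + Pi.single j 1),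
    L (p + Pi.single i 1 + Pi.single j 1)} : Finset α).card = 4 := by
    simp [*]
  omega

/-- The relation "the wall in direction `i` stops at the wall in direction `j`" at a top corner has
no cycle of length three. -/
theorem isWall_of_cycle (hL : IsBoxLabeling M L) {p : ι → ℤ} {i j k : ι} (hij : i ≠ j)
    (hjk : j ≠ k) (hki : k ≠ i) (hi : IsWall L i p) (hj : IsWall L j p) (hk : IsWall L k p)
    (h1 : ¬ IsWall L j (p + Pi.single i 1)) (h2 : ¬ IsWall L k (p + Pi.single j 1)) :
    IsWall L i (p + Pi.single k 1) := by
  classical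
  intro h3
  rw [IsWall, not_not] at h1 h2
  rw [IsWall] at hi hj hk
  have ij : L (p + Pi.single i 1) ≠ L (p + Pi.single j 1) := fun h => hi <| by
    refine hL.box _ _ p h fun t => ?_
    simp only [Pi.add_apply, Pi.single_apply]; grind
  have jk : L (p + Pi.single j 1) ≠ L (p + Pi.single k 1) := fun h => hj <| by
    refine hL.box _ _ p h fun t => ?_
    simp only [Pi.add_apply, Pi.single_apply]; grind
  have ik : L (p + Pi.single i 1) ≠ L (p + Pi.single k 1) := fun h => hi <| by
    refine hL.box _ _ p h fun t => ?_
    simp only [Pi.add_apply, Pi.single_apply]; grind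
  have h0 : L p ≠ L (p + Pi.single i 1 + Pi.single j 1 + Pi.single k 1) := fun h => hi <| by
    refine (hL.box _ _ _ h fun t => ?_).symm
    simp only [Pi.add_apply, Pi.single_apply]; grind
  have i0 : L (p + Pi.single i 1) ≠ L (p + Pi.single i 1 + Pi.single j 1 + Pi.single k 1) :=
    fun h => ik <| by
    rw [h3]
    refine (hL.box _ _ _ h fun t => ?_).symm
    simp only [Pi.add_apply, Pi.single_apply]; grind
  have j0 : L (p + Pi.single j 1) ≠ L (p + Pi.single i 1 + Pi.single j 1 + Pi.single k 1) :=
    fun h => ij.symm <| by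
    rw [h1]
    refine (hL.box _ _ _ h fun t => ?_).symm
    simp only [Pi.add_apply, Pi.single_apply]; grind
  have k0 : L (p + Pi.single k 1) ≠ L (p + Pi.single i 1 + Pi.single j 1 + Pi.single k 1) :=
    fun h => jk.symm <| by
    rw [h2]
    refine (hL.box _ _ _ h fun t => ?_).symm
    simp only [Pi.add_apply, Pi.single_apply]; grind
  have hcard := hL.few p {i, j, k} {L p, L (p + Pi.single i 1), L (p + Pi.single j 1),
    L (p + Pi.single k 1), L (p + Pi.single i 1 + Pi.single j 1 + Pi.single k 1)} (by
    intro τ hτ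
    simp only [Finset.mem_insert, Finset.mem_singleton] at hτ
    rcases hτ with rfl | rfl | rfl | rfl | rfl
    · exact ⟨_, fun t => by grind, rfl⟩
    all_goals
      refine ⟨_, fun t => ?_, rfl⟩
      simp only [Pi.add_apply, Pi.single_apply, Finset.mem_insert, Finset.mem_singleton]
      grind)
  have h5 := five_le_card hi hj hk h0 ij ik i0 jk j0 k0 (T := {L p, L (p + Pi.single i 1),
    L (p + Pi.single j 1), L (p + Pi.single k 1),
    L (p + Pi.single i 1 + Pi.single j 1 + Pi.single k 1)}) (by simp)
  have h6 : ({i, j, k} : Finset ι).card ≤ 3 := Finset.card_le_three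
  omega

/-- Among the walls at a top corner of a label class there is one which stops at all others. -/
theorem exists_stopping_wall (hL : IsBoxLabeling M L) {p : ι → ℤ} {J : Finset ι}
    (hJ : J.Nonempty) (h : ∀ i ∈ J, IsWall L i p) :
    ∃ i ∈ J, ∀ k ∈ J, k ≠ i → ¬ IsWall L i (p + Pi.single k 1) := by
  induction hJ using Finset.Nonempty.cons_induction with
  | singleton a => exact ⟨a, by simp, by simp +contextual⟩
  | cons a s ha hs ih =>
    obtain ⟨i, hi, hmin⟩ := ih fun i hi => h i (Finset.mem_cons_of_mem hi)
    have hwa := h a (Finset.mem_cons_self a s)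
    have hwi := h i (Finset.mem_cons_of_mem hi)
    have hai : a ≠ i := by rintro rfl; exact ha hi
    by_cases hd : IsWall L i (p + Pi.single a 1)
    · have hd' := (hL.not_isWall_or hai hwa hwi).resolve_left (not_not.2 hd)
      refine ⟨a, Finset.mem_cons_self a s, fun k hk hka => ?_⟩
      have hks := (Finset.mem_cons.1 hk).resolve_left hka
      by_cases hki : k = i
      · exact hki ▸ hd'
      intro hk'
      have hwk := h k hk
      have h1 := (hL.not_isWall_or hka hwk hwa).resolve_left (not_not.2 hk')
      -- Otherwise `k` stops at `a`, `a` stops at `i` and `i` stops at `k`, a forbidden 3-cycle.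
      exact hd' (hL.isWall_of_cycle hka.symm hki (Ne.symm hai) hwa hwk hwi h1 (hmin k hks hki))
    · refine ⟨i, Finset.mem_cons_of_mem hi, fun k hk hki => ?_⟩
      rcases Finset.mem_cons.1 hk with rfl | hk
      · exact hd
      · exact hmin k hk hki

theorem exists_isSuccLabel [Fintype ι] (hL : IsBoxLabeling M L) {τ : α}
    (hτ : τ ∈ L '' Set.Icc 0 M) (hne : τ ≠ L M) : ∃ τ', IsSuccLabel M L τ τ' := by
  classical
  obtain ⟨m, hm, hmax⟩ := Set.Finite.exists_maximal (s := {p | p ∈ Set.Icc 0 M ∧ L p = τ})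
    ((Set.finite_Icc 0 M).subset fun _ h => h.1) hτ
  obtain ⟨hm, rfl⟩ := hm
  have hwall : ∀ i, m i < M i → IsWall L i m := by
    intro i hi h
    have hle : m ≤ m + Pi.single i 1 := by simp
    have := hmax (y := m + Pi.single i 1) ⟨⟨hm.1.trans hle, fun t => ?_⟩, h.symm⟩ hle i
    · simp at this
    · have : m t ≤ M t := hm.2 t
      simp only [Pi.add_apply, Pi.single_apply]; grind
  have hJ : (Finset.univ.filter fun i => m i < M i).Nonempty := by
    by_contra hJ
    rw [Finset.not_nonempty_iff_eq_empty, Finset.filter_eq_empty_iff] at hJ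
    refine hne (congrArg L (le_antisymm hm.2 fun t => ?_))
    exact not_lt.1 (hJ (Finset.mem_univ t))
  obtain ⟨i, hi, htop⟩ := hL.exists_stopping_wall hJ fun i hi => hwall i (by simpa using hi)
  have hwi := hwall i (by simpa using hi)
  -- A minimal cell of the wall is its bottom corner: a wall cell just below it would again be
  -- related to `m`.
  obtain ⟨b, hb, hmin⟩ := Set.Finite.exists_minimal
    (s := {p | p ∈ Set.Icc 0 M ∧ WallRel L i m p})
    ((Set.finite_Icc 0 M).subset fun _ h => h.1) ⟨m, hm, WallRel.refl hwi⟩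
  refine ⟨_, i, m, b, hm, rfl, fun k hk hkM => htop k (by simpa using hkM) hk, hb.1, hb.2.symm,
    fun k hk hbk hw => ?_, rfl⟩
  have hle : b + Pi.single k (-1) ≤ b := by simp
  have := hmin (y := b + Pi.single k (-1)) ⟨⟨fun t => ?_, hle.trans hb.1.2⟩,
    hL.wallRel_add_single hk (Or.inr rfl) hb.2 hw⟩ hle k
  · simp at this
  · have : 0 ≤ b t := hb.1.1 t
    simp only [Pi.add_apply, Pi.single_apply, Pi.zero_apply]; grind

/-- The labels can be ordered linearly so that they increase along the coordinatewise order. -/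
theorem exists_monotone_rank [Fintype ι] (hL : IsBoxLabeling M L) :
    ∃ h : α → ℕ, (∀ p ∈ Set.Icc 0 M, ∀ q ∈ Set.Icc 0 M, h (L p) = h (L q) → L p = L q) ∧
      ∀ p ∈ Set.Icc 0 M, ∀ q ∈ Set.Icc 0 M, p ≤ q → h (L p) ≤ h (L q) := by
  classical
  have hsucc : ∀ τ, ∃ τ', τ ∈ L '' Set.Icc 0 M → τ ≠ L M → IsSuccLabel M L τ τ' := fun τ => by
    by_cases h : τ ∈ L '' Set.Icc 0 M ∧ τ ≠ L M
    · obtain ⟨τ', h'⟩ := hL.exists_isSuccLabel h.1 h.2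
      exact ⟨τ', fun _ _ => h'⟩
    · exact ⟨τ, fun h1 h2 => absurd ⟨h1, h2⟩ h⟩
  choose f hf using hsucc
  set T : ℕ → α := fun k => f^[k] (L 0) with hT
  have hT0 : T 0 = L 0 := rfl
  have hTs : ∀ k, T (k + 1) = f (T k) := fun k => Function.iterate_succ_apply' f k _
  have hmem : ∀ k, (∀ j < k, T j ≠ L M) → T k ∈ L '' Set.Icc 0 M := by
    intro k
    induction k with
    | zero => exact fun _ => ⟨0, ⟨le_rfl, hL.nonneg⟩, rfl⟩
    | succ k ih =>
      intro h
      rw [hTs]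
      exact hL.isSuccLabel_mem (hf _ (ih fun j hj => h j (by omega)) (h k (by omega)))
  have hend : ∃ k, T k = L M := by
    by_contra! hne
    have hs : ∀ k, IsSuccLabel M L (T k) (T (k + 1)) := fun k => by
      rw [hTs]; exact hf _ (hmem k fun j _ => hne j) (hne k)
    -- Injectivity of successors pulls a repetition back to the start of the chain, and no successor
    -- equals the label of the origin.
    have hinj : ∀ i j, T i = T (i + j) → j = 0 := by
      intro i
      induction i with
      | zero =>
        intro j hj
        by_contra hj0
        obtain ⟨j, rfl⟩ := Nat.exists_eq_succ_of_ne_zero hj0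
        rw [zero_add] at hj
        exact hL.isSuccLabel_ne (hs j) hj.symm
      | succ i ih =>
        intro j hj
        refine ih j (hL.isSuccLabel_injective (hs i) ?_)
        rw [hj, add_right_comm]
        exact hs _
    refine Set.infinite_of_injective_forall_mem (f := T) (fun i j hij => ?_)
      (fun k => hmem k fun j _ => hne j) ((Set.finite_Icc 0 M).image L)
    rcases le_total i j with h | h <;> obtain ⟨d, rfl⟩ := Nat.exists_eq_add_of_le h
    · simp [hinj i d hij]
    · simp [hinj j d hij.symm]
  have hmin : ∀ j < Nat.find hend, T j ≠ L M := fun j hj => Nat.find_min hend hj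
  have hclosed : ∀ k ≤ Nat.find hend, IsWallClosed M L {τ | ∃ j ≤ k, T j = τ} := by
    intro k
    induction k with
    | zero =>
      intro _
      convert hL.isWallClosed_singleton using 1
      ext τ
      simp [hT0, eq_comm]
    | succ k ih =>
      intro hk
      have hs := hf (T k) (hmem k fun j hj => hmin j (by omega)) (hmin k (by omega))
      convert hL.isWallClosed_insert (ih (by omega)) ⟨k, le_rfl, rfl⟩ hs using 1
      ext τ
      simp only [Set.mem_ofPred_eq, Set.mem_insert_iff, Nat.le_succ_iff]
      constructor
      · rintro ⟨j, hj | rfl, rfl⟩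
        · exact Or.inr ⟨j, hj, rfl⟩
        · exact Or.inl (hTs k)
      · rintro (rfl | ⟨j, hj, rfl⟩)
        · exact ⟨k + 1, Or.inr rfl, hTs k⟩
        · exact ⟨j, Or.inl hj, rfl⟩
  -- The completed chain is wall closed and contains the label of the highest cell, hence the label
  -- of every cell below it.
  have hall : ∀ p ∈ Set.Icc 0 M, ∃ j ≤ Nat.find hend, T j = L p := fun p hp =>
    (hclosed _ le_rfl).mem_of_le hp.1 le_rfl hp.2 ⟨_, le_rfl, Nat.find_spec hend⟩
  have hrank : ∀ p ∈ Set.Icc 0 M, T (sInf {j | T j = L p}) = L p ∧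
      sInf {j | T j = L p} ≤ Nat.find hend := fun p hp => by
    obtain ⟨j, hj, hjp⟩ := hall p hp
    exact ⟨Nat.sInf_mem (s := {j | T j = L p}) ⟨j, hjp⟩, (Nat.sInf_le hjp).trans hj⟩
  -- The rank is the first position in the chain. Labels outside the chain get the default 0, which
  -- does not matter because only cells of `[0, M]` are compared.
  refine ⟨fun τ => sInf {j | T j = τ}, fun p hp q hq h => ?_, fun p hp q hq hpq => ?_⟩
  · rw [← (hrank p hp).1, ← (hrank q hq).1]
    exact congrArg T h
  · obtain ⟨j, hj, hjp⟩ := (hclosed _ (hrank q hq).2).mem_of_le hp.1 hq.2 hpq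
      ⟨_, le_rfl, (hrank q hq).1⟩
    exact (Nat.sInf_le hjp).trans hj

end IsBoxLabeling

/-! ### Sampling an interval -/

/-- The points `g k` sample the interval `(a, b)` so finely that consecutive ones are separated by
at most one point of `S`. -/
structure IsSampling (S : Set ℝ) (a b : ℝ) (M : ℤ) (g : ℤ → ℝ) : Prop where
  nonneg : 0 ≤ M
  mem_Ioo : ∀ k, g k ∈ Set.Ioo a b
  notMem : ∀ k, g k ∉ S
  step : ∀ k, ∃ x ∈ Set.uIcc (g k) (g (k + 1)), ∀ s ∈ S, s ∈ Set.uIcc (g k) (g (k + 1)) → s = x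
  below : ∀ k < 0, g (k + 1) = g k
  above : ∀ k, M ≤ k → g (k + 1) = g k
  cover : ∀ c ∈ S, ∀ d ∈ S, c < d → a ≤ c → d ≤ b → ∃ k ∈ Set.Icc 0 M, g k ∈ Set.Ioo c d

theorem Set.Finite.exists_gap {S : Set ℝ} (hS : S.Finite) :
    ∃ δ > 0, ∀ s ∈ S, ∀ t ∈ S, s < t → δ ≤ t - s := by
  by_cases h : S.Nontrivial
  · refine ⟨S.infsep, hS.infsep_pos_iff_nontrivial.2 h, fun s hs t ht hst => ?_⟩
    have := Set.infsep_le_dist_of_mem hs ht hst.ne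
    rwa [Real.dist_eq, abs_sub_comm, abs_of_pos (sub_pos.2 hst)] at this
  · rw [Set.not_nontrivial_iff] at h
    exact ⟨1, one_pos, fun s hs t ht hst => absurd (h hs ht) hst.ne⟩

theorem exists_monotone_sampling {S : Set ℝ} (hS : S.Finite) {a b : ℝ} (hab : a < b) :
    ∃ M g, Monotone g ∧ IsSampling S a b M g := by
  obtain ⟨δ, hδ, hgap⟩ := hS.exists_gap
  obtain ⟨N, hN⟩ := exists_nat_gt ((b - a) / δ)
  have hN0 : (0 : ℝ) < N := (div_pos (sub_pos.2 hab) hδ).trans hN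
  have hN1 : (1 : ℤ) ≤ N := by exact_mod_cast hN0
  obtain ⟨h, hh⟩ : ∃ h, h = (b - a) / N := ⟨_, rfl⟩
  have h0 : 0 < h := hh ▸ div_pos (sub_pos.2 hab) hN0
  have hhδ : h < δ := by
    rw [hh, div_lt_iff₀ hN0, mul_comm, ← div_lt_iff₀ hδ]; exact hN
  have hNh : N * h = b - a := by rw [hh]; field_simp
  -- Only finitely many offsets put a sample on `S`, so a generic one avoids it. The mesh `h < δ`
  -- leaves at most one point of `S` between neighbouring samples and at least one sample between
  -- two points of `S`.
  obtain ⟨θ, hθ, hbad⟩ := (Set.Ioo_infinite (zero_lt_one' ℝ)).exists_notMem_finite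
    (Set.Finite.image2 (fun (s : ℝ) (k : ℤ) => (s - a) / h - k) hS (Set.finite_Icc (0 : ℤ) (N - 1)))
  let γ : ℤ → ℝ := fun k => a + (((max 0 (min k (N - 1)) : ℤ) : ℝ) + θ) * h
  have hmono : Monotone γ := fun k l hkl => by
    have : max 0 (min k ((N : ℤ) - 1)) ≤ max 0 (min l ((N : ℤ) - 1)) := by omega
    have : ((max 0 (min k ((N : ℤ) - 1)) : ℤ) : ℝ) ≤ ((max 0 (min l ((N : ℤ) - 1)) : ℤ) : ℝ) := by
      exact_mod_cast this
    simp only [γ]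
    gcongr
  have hstep : ∀ k, γ (k + 1) ≤ γ k + h := fun k => by
    have : max 0 (min (k + 1) ((N : ℤ) - 1)) ≤ max 0 (min k ((N : ℤ) - 1)) + 1 := by omega
    have : ((max 0 (min (k + 1) ((N : ℤ) - 1)) : ℤ) : ℝ) ≤
        ((max 0 (min k ((N : ℤ) - 1)) : ℤ) : ℝ) + 1 := by exact_mod_cast this
    simp only [γ]
    nlinarith
  refine ⟨N - 1, γ, hmono, ⟨by omega, fun k => ?_, fun k hk => ?_, fun k => ?_, fun k hk => ?_,
    fun k hk => ?_, fun c hc d hd hcd hac hdb => ?_⟩⟩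
  · have h1 : 0 ≤ max 0 (min k ((N : ℤ) - 1)) := by omega
    have h2 : max 0 (min k ((N : ℤ) - 1)) + 1 ≤ N := by omega
    have h1' : (0 : ℝ) ≤ ((max 0 (min k ((N : ℤ) - 1)) : ℤ) : ℝ) := by exact_mod_cast h1
    have h2' : ((max 0 (min k ((N : ℤ) - 1)) : ℤ) : ℝ) + 1 ≤ N := by exact_mod_cast h2
    have h3 := hθ.1
    have h4 := hθ.2
    constructor <;> simp only [γ]
    · have : 0 < (((max 0 (min k ((N : ℤ) - 1)) : ℤ) : ℝ) + θ) * h := by positivity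
      linarith
    · have : (((max 0 (min k ((N : ℤ) - 1)) : ℤ) : ℝ) + θ) * h < N * h := by gcongr; linarith
      linarith
  · refine hbad ⟨γ k, hk, max 0 (min k ((N : ℤ) - 1)), ⟨by omega, by omega⟩, ?_⟩
    simp only [γ]
    field_simp
    ring
  · rw [Set.uIcc_of_le (hmono (by omega))]
    by_cases hs : ∃ s ∈ S, s ∈ Set.Icc (γ k) (γ (k + 1))
    · obtain ⟨s, hs, hsk⟩ := hs
      refine ⟨s, hsk, fun t ht htk => ?_⟩
      by_contra hne
      have h1 := hstep k
      rcases lt_or_gt_of_ne hne with h2 | h2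
      · have := hgap t ht s hs h2
        linarith [hsk.2, htk.1]
      · have := hgap s hs t ht h2
        linarith [hsk.1, htk.2]
    · exact ⟨γ k, ⟨le_rfl, hmono (by omega)⟩, fun s hsS hsk => absurd ⟨s, hsS, hsk⟩ hs⟩
  · have : max 0 (min (k + 1) ((N : ℤ) - 1)) = max 0 (min k ((N : ℤ) - 1)) := by omega
    simp only [γ, this]
  · have : max 0 (min (k + 1) ((N : ℤ) - 1)) = max 0 (min k ((N : ℤ) - 1)) := by omega
    simp only [γ, this]
  · have hd' := hgap c hc d hd hcd
    have hf1 := Int.floor_le ((c - a) / h - θ)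
    have hf2 := Int.lt_floor_add_one ((c - a) / h - θ)
    -- Sample `k + 1` of the unclamped grid is the first one beyond `c`; it exceeds `c` by at most
    -- `h < δ ≤ d - c`.
    set k := ⌊(c - a) / h - θ⌋ with hk
    have e : (c - a) / h * h = c - a := div_mul_cancel₀ _ h0.ne'
    have hlo : c < a + ((k + 1 : ℝ) + θ) * h := by nlinarith
    have hhi : a + ((k + 1 : ℝ) + θ) * h < d := by nlinarith
    have hk0 : 0 ≤ k + 1 := by
      have : (-1 : ℝ) < k + 1 := by
        have : 0 ≤ (c - a) / h := div_nonneg (by linarith) h0.le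
        linarith [hθ.2]
      have : (-1 : ℤ) < k + 1 := by exact_mod_cast this
      omega
    have hkN : k + 1 ≤ N - 1 := by
      have : ((k + 1 : ℝ) + θ) * h < N * h := by linarith
      have := lt_of_mul_lt_mul_right this h0.le
      have : (k + 1 : ℝ) < N := by linarith [hθ.1]
      have : k + 1 < (N : ℤ) := by exact_mod_cast this
      omega
    refine ⟨k + 1, ⟨hk0, hkN⟩, ?_⟩
    have : max 0 (min (k + 1) ((N : ℤ) - 1)) = k + 1 := by omega
    simp only [γ, this]
    push_cast
    exact ⟨hlo, hhi⟩

theorem exists_antitone_sampling {S : Set ℝ} (hS : S.Finite) {a b : ℝ} (hab : a < b) :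
    ∃ M g, Antitone g ∧ IsSampling S a b M g := by
  obtain ⟨M, g, hg, h⟩ := exists_monotone_sampling hS hab
  refine ⟨M, fun k => g (M - k), fun k l hkl => hg (by omega), h.nonneg, fun k => h.mem_Ioo _,
    fun k => h.notMem _, fun k => ?_, fun k hk => ?_, fun k hk => ?_,
    fun c hc d hd hcd hac hdb => ?_⟩
  · have := h.step (M - (k + 1))
    rwa [show M - (k + 1) + 1 = M - k by ring, Set.uIcc_comm] at this
  · have := h.above (M - (k + 1)) (by omega)
    rw [← this]; congr 1; ring
  · have := h.below (M - (k + 1)) (by omega)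
    rw [← this]; congr 1; ring
  · obtain ⟨k, hk, hkc⟩ := h.cover c hc d hd hcd hac hdb
    refine ⟨M - k, ⟨by linarith [hk.2], by linarith [hk.1]⟩, ?_⟩
    simpa using hkc

/-! ### From minimal partitions to box labellings -/

theorem mem_interior_Icc_pi {n : ℕ} {c d x : Fin n → ℝ} :
    x ∈ interior (Set.Icc c d) ↔ ∀ i, c i < x i ∧ x i < d i := by
  rw [← Set.pi_univ_Icc, interior_pi_set Set.finite_univ]
  simp [interior_Icc]

theorem Icc_pi_inj {n : ℕ} {a b c d : Fin n → ℝ} (hab : ∀ i, a i < b i)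
    (h : Set.Icc a b = Set.Icc c d) : a = c ∧ b = d :=
  (Set.Icc_eq_Icc_iff fun i => (hab i).le).1 h

theorem exists_bounds_of_isRectangle {n : ℕ} {P : Set (Set (Fin n → ℝ))}
    (hP : ∀ Q ∈ P, IsRectangle Q) :
    ∃ lo hi : Set (Fin n → ℝ) → Fin n → ℝ,
      ∀ Q ∈ P, (∀ i, lo Q i < hi Q i) ∧ Q = Set.Icc (lo Q) (hi Q) := by
  have : ∀ Q, ∃ c d : Fin n → ℝ, Q ∈ P → (∀ i, c i < d i) ∧ Q = Set.Icc c d := fun Q => by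
    by_cases hQ : Q ∈ P
    · obtain ⟨c, d, h⟩ := hP Q hQ
      exact ⟨c, d, fun _ => h⟩
    · exact ⟨0, 0, fun h => absurd h hQ⟩
  choose lo hi h using this
  exact ⟨lo, hi, h⟩

theorem isBoundaryVector_iff {n : ℕ} {P : Set (Set (Fin n → ℝ))} {lo hi : Set (Fin n → ℝ) → Fin n → ℝ}
    (h : ∀ Q ∈ P, (∀ i, lo Q i < hi Q i) ∧ Q = Set.Icc (lo Q) (hi Q)) {x : Fin n → ℝ} {i : Fin n} :
    IsBoundaryVector P x i ↔ ∃ Q ∈ P, x ∈ Q ∧ (x i = lo Q i ∨ x i = hi Q i) := by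
  constructor
  · rintro ⟨Q, hQ, F, ⟨c, d, hcd, hQe, hF⟩, hx⟩
    obtain ⟨rfl, rfl⟩ := Icc_pi_inj hcd (hQe.symm.trans (h Q hQ).2)
    rcases hF with rfl | rfl
    · exact ⟨Q, hQ, hx.1, Or.inl hx.2⟩
    · exact ⟨Q, hQ, hx.1, Or.inr hx.2⟩
  · rintro ⟨Q, hQ, hx, hxi | hxi⟩
    · exact ⟨Q, hQ, _, ⟨_, _, (h Q hQ).1, (h Q hQ).2, Or.inl rfl⟩, hx, hxi⟩
    · exact ⟨Q, hQ, _, ⟨_, _, (h Q hQ).1, (h Q hQ).2, Or.inr rfl⟩, hx, hxi⟩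

/-- For every orientation `ρ` of the axes, the members of a minimal partition can be ordered
linearly along the orthant of directions given by `ρ`. -/
theorem IsMinimalLocallyRegulatedPartition.exists_rank {n : ℕ} {a b : Fin n → ℝ}
    (hab : ∀ i, a i < b i) {P : Set (Set (Fin n → ℝ))}
    (hP : IsMinimalLocallyRegulatedPartition (Set.Icc a b) P) (ρ : Fin n → Prop) :
    ∃ h : Set (Fin n → ℝ) → ℕ, Set.InjOn h P ∧
      ∀ c d c' d' : Fin n → ℝ, (∀ i, c i < d i) → (∀ i, c' i < d' i) →
        Set.Icc c d ∈ P → Set.Icc c' d' ∈ P →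
        (∀ i, max (c i) (c' i) < min (d i) (d' i) ∨
          (ρ i ∧ d' i ≤ c i) ∨ (¬ ρ i ∧ d i ≤ c' i)) →
        h (Set.Icc c d) ≤ h (Set.Icc c' d') := by
  obtain ⟨lo, hi, hlh⟩ := exists_bounds_of_isRectangle hP.isRectangle
  let S : Fin n → Set ℝ := fun i => (fun Q => lo Q i) '' P ∪ (fun Q => hi Q i) '' P
  have hSlo : ∀ Q ∈ P, ∀ i, lo Q i ∈ S i := fun Q hQ i => Or.inl ⟨Q, hQ, rfl⟩
  have hShi : ∀ Q ∈ P, ∀ i, hi Q i ∈ S i := fun Q hQ i => Or.inr ⟨Q, hQ, rfl⟩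
  have hSfin : ∀ i, (S i).Finite := fun i => (hP.finite.image _).union (hP.finite.image _)
  have hbd : ∀ Q ∈ P, ∀ i, a i ≤ lo Q i ∧ hi Q i ≤ b i := fun Q hQ i => by
    have hsub : Q ⊆ Set.Icc a b := hP.sUnion_eq ▸ Set.subset_sUnion_of_mem hQ
    obtain ⟨h1, h2⟩ := hlh Q hQ
    rw [h2] at hsub
    have hle : lo Q ≤ hi Q := fun i => (h1 i).le
    exact ⟨(hsub (Set.left_mem_Icc.2 hle)).1 i, (hsub (Set.right_mem_Icc.2 hle)).2 i⟩
  -- Axes with `ρ i` are sampled backwards, so that increasing indices always run along the chosen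
  -- orthant.
  have hsamp : ∀ i, ∃ M g, IsSampling (S i) (a i) (b i) M g ∧ (ρ i → Antitone g) ∧
      (¬ ρ i → Monotone g) := fun i => by
    by_cases hρ : ρ i
    · obtain ⟨M, g, hg, h⟩ := exists_antitone_sampling (hSfin i) (hab i)
      exact ⟨M, g, h, fun _ => hg, fun h => absurd hρ h⟩
    · obtain ⟨M, g, hg, h⟩ := exists_monotone_sampling (hSfin i) (hab i)
      exact ⟨M, g, h, fun h => absurd h hρ, fun _ => hg⟩
  choose M g hg hanti hmono using hsamp
  have hex : ∀ p : Fin n → ℤ, ∃ Q ∈ P, (fun i => g i (p i)) ∈ Q := fun p => by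
    have : (fun i => g i (p i)) ∈ ⋃₀ P := by
      rw [hP.sUnion_eq]
      exact ⟨fun i => ((hg i).mem_Ioo _).1.le, fun i => ((hg i).mem_Ioo _).2.le⟩
    exact this
  choose L hLP hLmem using hex
  have hstrict : ∀ Q ∈ P, ∀ p : Fin n → ℤ, (fun i => g i (p i)) ∈ Q → ∀ i, lo Q i < g i (p i) ∧
      g i (p i) < hi Q i := fun Q hQ p hp i => by
    rw [(hlh Q hQ).2] at hp
    refine ⟨lt_of_le_of_ne (hp.1 i) fun h => ?_, lt_of_le_of_ne (hp.2 i) fun h => ?_⟩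
    · exact (hg i).notMem (p i) (h ▸ hSlo Q hQ i)
    · exact (hg i).notMem (p i) (h.symm ▸ hShi Q hQ i)
  have huniq : ∀ Q ∈ P, ∀ p : Fin n → ℤ, (fun i => g i (p i)) ∈ Q → L p = Q := fun Q hQ p hp => by
    by_contra hne
    have := hP.disjoint_interior _ (hLP p) Q hQ hne
    refine (Set.eq_empty_iff_forall_notMem.1 this) (fun i => g i (p i)) ⟨?_, ?_⟩
    · rw [(hlh _ (hLP p)).2, mem_interior_Icc_pi]
      exact hstrict _ (hLP p) p (hLmem p)
    · rw [(hlh Q hQ).2, mem_interior_Icc_pi]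
      exact hstrict Q hQ p hp
  have hbetween : ∀ i k l m, k ≤ m ∧ m ≤ l ∨ l ≤ m ∧ m ≤ k →
      g i k ≤ g i m ∧ g i m ≤ g i l ∨ g i l ≤ g i m ∧ g i m ≤ g i k := fun i k l m h => by
    by_cases hρ : ρ i
    · rcases h with h | h
      · exact Or.inr ⟨hanti i hρ h.2, hanti i hρ h.1⟩
      · exact Or.inl ⟨hanti i hρ h.2, hanti i hρ h.1⟩
    · rcases h with h | h
      · exact Or.inl ⟨hmono i hρ h.1, hmono i hρ h.2⟩
      · exact Or.inr ⟨hmono i hρ h.1, hmono i hρ h.2⟩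
  have hclamp : ∀ p i, g i (p i + 1) = g i (p i) → L (p + Pi.single i 1) = L p := fun p i h => by
    refine huniq _ (hLP p) _ ?_
    convert hLmem p using 2 with j
    by_cases hj : j = i
    · subst hj; simp [h]
    · simp [hj]
  have hL : IsBoxLabeling M L := by
    refine ⟨fun i => (hg i).nonneg, fun p q r hpq hr => ?_, fun p i hi => ?_, fun p i hi => ?_,
      fun p J T hT => ?_⟩
    · refine huniq _ (hLP p) _ ?_
      have hp := hLmem p
      have hq := hLmem q
      rw [← hpq] at hq
      rw [(hlh _ (hLP p)).2] at hp hq ⊢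
      constructor <;> intro i <;> have h1 := hbetween i _ _ _ (hr i) <;> have h2 := hp.1 i <;>
        have h3 := hp.2 i <;> have h4 := hq.1 i <;> have h5 := hq.2 i <;> dsimp only at * <;>
        rcases h1 with h1 | h1 <;> linarith
    · exact hclamp p i ((hg i).below _ hi)
    · exact hclamp p i ((hg i).above _ hi)
    -- The corner becomes a point `x`: on the axes in `J` it takes the only possible side position
    -- between the two samples, elsewhere the sample itself. Every member seen around the corner
    -- contains `x`, and its boundary vectors lie in `J`, so minimality at `x` bounds their number.
    · choose y hy hyS using fun i => (hg i).step (p i)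
      set x : Fin n → ℝ := fun i => if i ∈ J then y i else g i (p i) with hx
      have hxint : x ∈ interior (Set.Icc a b) := by
        rw [mem_interior_Icc_pi]
        intro i
        simp only [hx]
        split_ifs
        · exact Set.ordConnected_Ioo.uIcc_subset ((hg i).mem_Ioo _) ((hg i).mem_Ioo _) (hy i)
        · exact (hg i).mem_Ioo _
      have hcard := hP.minimal x hxint
      have h1 : (T : Set (Set (Fin n → ℝ))) ⊆ {Q ∈ P | x ∈ Q} := by
        intro Q hQ
        obtain ⟨q, hq, rfl⟩ := hT Q hQ
        refine ⟨hLP q, ?_⟩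
        have hs := hstrict _ (hLP q) q (hLmem q)
        have key : ∀ i, lo (L q) i ≤ x i ∧ x i ≤ hi (L q) i := fun i => by
          have hqi := hq i
          simp only [hx]
          split_ifs at hqi ⊢ with hi
          · have hgq : g i (q i) ∈ Set.uIcc (g i (p i)) (g i (p i + 1)) := by
              obtain h | h : q i = p i ∨ q i = p i + 1 := by omega
              · rw [h]; exact Set.left_mem_uIcc
              · rw [h]; exact Set.right_mem_uIcc
            constructor
            · by_contra hc
              refine hc (hyS i _ (hSlo _ (hLP q) i) ?_).le
              exact Set.ordConnected_uIcc.out (hy i) hgq ⟨(not_le.1 hc).le, (hs i).1.le⟩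
            · by_contra hc
              refine hc (hyS i _ (hShi _ (hLP q) i) ?_).ge
              exact Set.ordConnected_uIcc.out hgq (hy i) ⟨(hs i).2.le, (not_le.1 hc).le⟩
          · have : q i = p i := by omega
            rw [← this]
            exact ⟨(hs i).1.le, (hs i).2.le⟩
        rw [(hlh _ (hLP q)).2]
        exact ⟨fun i => (key i).1, fun i => (key i).2⟩
      have h2 : {i | IsBoundaryVector P x i} ⊆ (J : Set (Fin n)) := by
        intro i hi
        rw [Set.mem_ofPred_eq, isBoundaryVector_iff hlh] at hi
        obtain ⟨Q, hQ, -, hi⟩ := hi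
        by_contra hJ
        have hxi : x i = g i (p i) := if_neg hJ
        rw [hxi] at hi
        rcases hi with hi | hi
        · exact (hg i).notMem (p i) (hi ▸ hSlo Q hQ i)
        · exact (hg i).notMem (p i) (hi ▸ hShi Q hQ i)
      have h3 := Set.ncard_le_ncard h1 (hP.finite.subset fun Q hQ => hQ.1)
      have h4 := Set.ncard_le_ncard h2 J.finite_toSet
      rw [Set.ncard_coe_finset] at h3 h4
      rw [partitionNumber, boundaryRank] at hcard
      omega
  obtain ⟨h, hinj, hmon⟩ := hL.exists_monotone_rank
  have hcov : ∀ c d : Fin n → ℝ, (∀ i, c i < d i) → Set.Icc c d ∈ P →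
      ∀ i, c i ∈ S i ∧ d i ∈ S i ∧ a i ≤ c i ∧ d i ≤ b i := fun c d hcd hQ i => by
    obtain ⟨h1, h2⟩ := Icc_pi_inj hcd (hlh _ hQ).2
    have h3 := hbd _ hQ i
    have h4 := hSlo _ hQ i
    have h5 := hShi _ hQ i
    rw [← h1] at h3 h4
    rw [← h2] at h3 h5
    exact ⟨h4, h5, h3⟩
  refine ⟨h, fun Q hQ Q' hQ' heq => ?_, fun c d c' d' hcd hcd' hQ hQ' hrel => ?_⟩
  · have hcell : ∀ Q ∈ P, ∃ p ∈ Set.Icc 0 M, L p = Q := fun Q hQ => by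
      have : ∀ i, ∃ k ∈ Set.Icc 0 (M i), g i k ∈ Set.Ioo (lo Q i) (hi Q i) := fun i =>
        (hg i).cover _ (hSlo Q hQ i) _ (hShi Q hQ i) ((hlh Q hQ).1 i) (hbd Q hQ i).1 (hbd Q hQ i).2
      choose p hp hpg using this
      refine ⟨p, ⟨fun i => (hp i).1, fun i => (hp i).2⟩, huniq Q hQ p ?_⟩
      rw [(hlh Q hQ).2]
      exact ⟨fun i => (hpg i).1.le, fun i => (hpg i).2.le⟩
    obtain ⟨p, hp, rfl⟩ := hcell Q hQ
    obtain ⟨q, hq, rfl⟩ := hcell Q' hQ'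
    exact hinj p hp q hq heq
  -- On an axis with overlap one common sample serves both members; on a separated axis the
  -- orientation forces `k ≤ l`. The resulting cells are comparable coordinatewise.
  · have hpair : ∀ i, ∃ k ∈ Set.Icc 0 (M i), ∃ l ∈ Set.Icc 0 (M i), k ≤ l ∧
        g i k ∈ Set.Ioo (c i) (d i) ∧ g i l ∈ Set.Ioo (c' i) (d' i) := fun i => by
      obtain ⟨s1, s2, s3, s4⟩ := hcov c d hcd hQ i
      obtain ⟨t1, t2, t3, t4⟩ := hcov c' d' hcd' hQ' i
      by_cases hov : max (c i) (c' i) < min (d i) (d' i)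
      · obtain ⟨k, hk, hkg⟩ := (hg i).cover (max (c i) (c' i))
          (by rcases max_choice (c i) (c' i) with h | h <;> rw [h] <;> assumption)
          (min (d i) (d' i))
          (by rcases min_choice (d i) (d' i) with h | h <;> rw [h] <;> assumption) hov
          (le_max_of_le_left s3) (min_le_of_left_le s4)
        simp only [Set.mem_Ioo, max_lt_iff, lt_min_iff] at hkg
        exact ⟨k, hk, k, hk, le_rfl, ⟨hkg.1.1, hkg.2.1⟩, ⟨hkg.1.2, hkg.2.2⟩⟩
      · obtain ⟨k, hk, hkg⟩ := (hg i).cover _ s1 _ s2 (hcd i) s3 s4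
        obtain ⟨l, hl, hlg⟩ := (hg i).cover _ t1 _ t2 (hcd' i) t3 t4
        refine ⟨k, hk, l, hl, ?_, hkg, hlg⟩
        by_contra hkl
        rcases (hrel i).resolve_left hov with ⟨hρ, hle⟩ | ⟨hρ, hle⟩
        · have := hanti i hρ (not_le.1 hkl).le
          linarith [hkg.1, hlg.2]
        · have := hmono i hρ (not_le.1 hkl).le
          linarith [hkg.2, hlg.1]
    choose p hp q hq hpq hpg hqg using hpair
    rw [← huniq _ hQ p ⟨fun i => (hpg i).1.le, fun i => (hpg i).2.le⟩,
      ← huniq _ hQ' q ⟨fun i => (hqg i).1.le, fun i => (hqg i).2.le⟩]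
    exact hmon p ⟨fun i => (hp i).1, fun i => (hp i).2⟩ q ⟨fun i => (hq i).1, fun i => (hq i).2⟩ hpq

/-- A minimal partition has no three members that follow one another cyclically along the
directions of an orthant. -/
theorem IsMinimalLocallyRegulatedPartition.not_cyclic {n : ℕ} {a b : Fin n → ℝ}
    (hab : ∀ i, a i < b i) {P : Set (Set (Fin n → ℝ))}
    (hP : IsMinimalLocallyRegulatedPartition (Set.Icc a b) P) (ρ : Fin n → Prop)
    {c₁ d₁ c₂ d₂ c₃ d₃ : Fin n → ℝ} (h₁ : ∀ i, c₁ i < d₁ i) (h₂ : ∀ i, c₂ i < d₂ i)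
    (h₃ : ∀ i, c₃ i < d₃ i) (hne : c₁ ≠ c₂)
    (m₁ : Set.Icc c₁ d₁ ∈ P) (m₂ : Set.Icc c₂ d₂ ∈ P) (m₃ : Set.Icc c₃ d₃ ∈ P)
    (h₁₂ : ∀ i, max (c₁ i) (c₂ i) < min (d₁ i) (d₂ i) ∨
      (ρ i ∧ d₂ i ≤ c₁ i) ∨ (¬ ρ i ∧ d₁ i ≤ c₂ i))
    (h₂₃ : ∀ i, max (c₂ i) (c₃ i) < min (d₂ i) (d₃ i) ∨
      (ρ i ∧ d₃ i ≤ c₂ i) ∨ (¬ ρ i ∧ d₂ i ≤ c₃ i))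
    (h₃₁ : ∀ i, max (c₃ i) (c₁ i) < min (d₃ i) (d₁ i) ∨
      (ρ i ∧ d₁ i ≤ c₃ i) ∨ (¬ ρ i ∧ d₃ i ≤ c₁ i)) : False := by
  obtain ⟨h, hinj, hmon⟩ := hP.exists_rank hab ρ
  have h12 := hmon _ _ _ _ h₁ h₂ m₁ m₂ h₁₂
  have h23 := hmon _ _ _ _ h₂ h₃ m₂ m₃ h₂₃
  have h31 := hmon _ _ _ _ h₃ h₁ m₃ m₁ h₃₁
  exact hne (Icc_pi_inj h₁ (hinj m₁ m₂ (by omega))).1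

/-! ### The three cyclic blocks -/

/-- The point of the rectangle `Icc a b` with coordinates `x`, `y`, `z`, `w`, `w`, … on the scale on
which all sides have length `4`. -/
noncomputable def gridPoint {n : ℕ} (a b : Fin n → ℝ) (x y z w : ℝ) : Fin n → ℝ := fun i =>
  a i + (b i - a i) / 4 * if i.val = 0 then x else if i.val = 1 then y else if i.val = 2 then z else w

theorem gridPoint_le {n : ℕ} {a b : Fin n → ℝ} (hab : ∀ i, a i < b i) {x y z w x' y' z' w' : ℝ}
    (i : Fin n) : gridPoint a b x y z w i ≤ gridPoint a b x' y' z' w' i ↔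
      (if i.val = 0 then x else if i.val = 1 then y else if i.val = 2 then z else w) ≤
      (if i.val = 0 then x' else if i.val = 1 then y' else if i.val = 2 then z' else w') := by
  have : 0 < (b i - a i) / 4 := by linarith [hab i]
  rw [gridPoint, gridPoint, add_le_add_iff_left, mul_le_mul_iff_right₀ this]

theorem gridPoint_lt {n : ℕ} {a b : Fin n → ℝ} (hab : ∀ i, a i < b i) {x y z w x' y' z' w' : ℝ}
    (i : Fin n) : gridPoint a b x y z w i < gridPoint a b x' y' z' w' i ↔
      (if i.val = 0 then x else if i.val = 1 then y else if i.val = 2 then z else w) <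
      (if i.val = 0 then x' else if i.val = 1 then y' else if i.val = 2 then z' else w') := by
  rw [← not_le, gridPoint_le hab, not_le]

/-- The three blocks of `cubeBlocks`, rescaled to `Icc a b` and extended over the other axes. -/
def gridBlocks {n : ℕ} (a b : Fin n → ℝ) : Set (Set (Fin n → ℝ)) :=
  {Set.Icc (gridPoint a b 0 0 0 0) (gridPoint a b 3 2 1 4),
    Set.Icc (gridPoint a b 2 3 0 0) (gridPoint a b 4 4 3 4),
    Set.Icc (gridPoint a b 0 1 2 0) (gridPoint a b 1 4 4 4)}

theorem Icc_inter_Icc_eq_empty_of_lt {ι : Type*} {c d c' d' : ι → ℝ} (i : ι)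
    (h : d i < c' i) : Set.Icc c d ∩ Set.Icc c' d' = ∅ := by
  refine Set.eq_empty_of_forall_notMem fun x hx => ?_
  linarith [hx.1.2 i, hx.2.1 i]

theorem gridBlocks_isDisjointSubrectangles {n : ℕ} (hn : 3 ≤ n) {a b : Fin n → ℝ}
    (hab : ∀ i, a i < b i) : IsDisjointSubrectangles (Set.Icc a b) (gridBlocks a b) := by
  have h0 : a = gridPoint a b 0 0 0 0 := by
    funext i; simp [gridPoint]
  have h4 : b = gridPoint a b 4 4 4 4 := by
    funext i; simp [gridPoint]
  have d12 : Set.Icc (gridPoint a b 0 0 0 0) (gridPoint a b 3 2 1 4) ∩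
      Set.Icc (gridPoint a b 2 3 0 0) (gridPoint a b 4 4 3 4) = ∅ :=
    Icc_inter_Icc_eq_empty_of_lt ⟨1, by omega⟩ (by rw [gridPoint_lt hab]; norm_num)
  have d13 : Set.Icc (gridPoint a b 0 0 0 0) (gridPoint a b 3 2 1 4) ∩
      Set.Icc (gridPoint a b 0 1 2 0) (gridPoint a b 1 4 4 4) = ∅ :=
    Icc_inter_Icc_eq_empty_of_lt ⟨2, by omega⟩ (by rw [gridPoint_lt hab]; norm_num)
  have d32 : Set.Icc (gridPoint a b 0 1 2 0) (gridPoint a b 1 4 4 4) ∩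
      Set.Icc (gridPoint a b 2 3 0 0) (gridPoint a b 4 4 3 4) = ∅ :=
    Icc_inter_Icc_eq_empty_of_lt ⟨0, by omega⟩ (by rw [gridPoint_lt hab]; norm_num)
  refine ⟨by simp [gridBlocks], ?_, ?_, ?_⟩
  · rintro Q (rfl | rfl | rfl) <;> refine ⟨_, _, fun i => ?_, rfl⟩ <;> rw [gridPoint_lt hab] <;>
      split_ifs <;> norm_num
  · have hs : ∀ c d : Fin n → ℝ, (∀ i, gridPoint a b 0 0 0 0 i ≤ c i) →
        (∀ i, d i ≤ gridPoint a b 4 4 4 4 i) → Set.Icc c d ⊆ Set.Icc a b := fun c d h1 h2 =>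
      Set.Icc_subset_Icc (by rw [h0]; exact h1) (by rw [h4]; exact h2)
    rintro Q (rfl | rfl | rfl) <;> refine hs _ _ (fun i => ?_) (fun i => ?_) <;>
      rw [gridPoint_le hab] <;> split_ifs <;> norm_num
  · rintro Q (rfl | rfl | rfl) Q' (rfl | rfl | rfl) hne <;>
      first
      | exact absurd rfl hne
      | assumption
      | rwa [Set.inter_comm]

theorem gridBlocks_not_subset {n : ℕ} (hn : 3 ≤ n) {a b : Fin n → ℝ} (hab : ∀ i, a i < b i) :
    ¬ ∃ P, IsMinimalLocallyRegulatedPartition (Set.Icc a b) P ∧ gridBlocks a b ⊆ P := by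
  rintro ⟨P, hP, hsub⟩
  -- Each consecutive pair is separated on one axis only: first to second upwards on axis 1, second
  -- to third downwards on axis 0, third to first downwards on axis 2. Hence axes 0 and 2 are
  -- reversed and axis 1 is not; on the axes beyond 2 the blocks overlap, so the orientation there
  -- is immaterial.
  refine hP.not_cyclic hab (fun i => i.val ≠ 1) (fun i => ?_) (fun i => ?_) (fun i => ?_)
    (fun h => ?_) (hsub (Or.inl rfl)) (hsub (Or.inr (Or.inl rfl))) (hsub (Or.inr (Or.inr rfl)))
    (fun i => ?_) (fun i => ?_) (fun i => ?_)
  iterate 3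
    rw [gridPoint_lt hab]
    split_ifs <;> norm_num
  · have := (gridPoint_lt hab (x := 0) (y := 0) (z := 0) (w := 0) (x' := 2) (y' := 3) (z' := 0)
      (w' := 0) ⟨0, by omega⟩).2 (by norm_num)
    exact this.ne (congrFun h _)
  all_goals
    simp only [max_lt_iff, lt_min_iff, gridPoint_lt hab, gridPoint_le hab]
    split_ifs with h0 h1 h2 <;> norm_num [*]

theorem cubeR_eq : cubeR = Set.Icc (fun _ => 0) (fun _ => 4) := by
  rw [cubeR]
  congr 1 <;> funext i <;> fin_cases i <;> rfl

theorem gridPoint_cube (x y z w : ℝ) :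
    gridPoint (fun _ : Fin 3 => 0) (fun _ => 4) x y z w = ![x, y, z] := by
  funext i
  fin_cases i <;> norm_num [gridPoint]

theorem cubeBlocks_eq : cubeBlocks = gridBlocks (fun _ => 0) (fun _ => 4) := by
  simp only [cubeBlocks, gridBlocks, gridPoint_cube]

/-! ### Germs of members at a point, and minimality in the plane -/

/-- The rectangle `Icc c d` contains all points close to `x` in the orthant of `x` given by `s`. -/
def HasGerm {n : ℕ} (c d x : Fin n → ℝ) (s : Fin n → Bool) : Prop :=
  ∀ i, if s i then c i ≤ x i ∧ x i < d i else c i < x i ∧ x i ≤ d i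

theorem HasGerm.mem {n : ℕ} {c d x : Fin n → ℝ} {s : Fin n → Bool} (h : HasGerm c d x s) :
    x ∈ Set.Icc c d := by
  constructor <;> intro i <;> have := h i <;> split_ifs at this <;> linarith

theorem exists_hasGerm_of_mem {n : ℕ} {c d x : Fin n → ℝ} (hcd : ∀ i, c i < d i)
    (hx : x ∈ Set.Icc c d) : ∃ s, HasGerm c d x s := by
  refine ⟨fun i => decide (x i < d i), fun i => ?_⟩
  have h1 : c i ≤ x i := hx.1 i
  have h2 : x i ≤ d i := hx.2 i
  have h3 := hcd i
  by_cases h : x i < d i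
  · simp [h, h1]
  · simp [h, h2]; linarith

namespace IsLocallyRegulatedPartition

variable {n : ℕ} {a b : Fin n → ℝ} {P : Set (Set (Fin n → ℝ))}
  {lo hi : Set (Fin n → ℝ) → Fin n → ℝ}

/-- Two rectangles filling the same orthant near `x` overlap in an open interval on every axis, so
their interiors meet. -/
theorem eq_of_hasGerm {R : Set (Fin n → ℝ)} (hP : IsLocallyRegulatedPartition R P)
    (hlh : ∀ Q ∈ P, (∀ i, lo Q i < hi Q i) ∧ Q = Set.Icc (lo Q) (hi Q)) {x : Fin n → ℝ}
    {s : Fin n → Bool} {Q Q' : Set (Fin n → ℝ)} (hQ : Q ∈ P) (hQ' : Q' ∈ P)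
    (h : HasGerm (lo Q) (hi Q) x s) (h' : HasGerm (lo Q') (hi Q') x s) : Q = Q' := by
  by_contra hne
  have hov : ∀ i, max (lo Q i) (lo Q' i) < min (hi Q i) (hi Q' i) := fun i => by
    have h1 := h i
    have h2 := h' i
    split_ifs at h1 h2
    · exact (max_le h1.1 h2.1).trans_lt (lt_min h1.2 h2.2)
    · exact (max_lt h1.1 h2.1).trans_le (le_min h1.2 h2.2)
  choose y hy1 hy2 using fun i => exists_between (hov i)
  refine Set.eq_empty_iff_forall_notMem.1 (hP.disjoint_interior Q hQ Q' hQ' hne) y ⟨?_, ?_⟩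
  · rw [(hlh Q hQ).2, mem_interior_Icc_pi]
    exact fun i => ⟨(le_max_left _ _).trans_lt (hy1 i), (hy2 i).trans_le (min_le_left _ _)⟩
  · rw [(hlh Q' hQ').2, mem_interior_Icc_pi]
    exact fun i => ⟨(le_max_right _ _).trans_lt (hy1 i), (hy2 i).trans_le (min_le_right _ _)⟩

/-- Move `x` by `ε` into the orthant, with `ε` below every nonzero distance from `x` to a side. A
member containing the moved point then fills the orthant near `x`, since no side lies strictly
between. -/
theorem exists_hasGerm (hP : IsLocallyRegulatedPartition (Set.Icc a b) P)
    (hlh : ∀ Q ∈ P, (∀ i, lo Q i < hi Q i) ∧ Q = Set.Icc (lo Q) (hi Q)) {x : Fin n → ℝ}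
    (hx : x ∈ interior (Set.Icc a b)) (s : Fin n → Bool) :
    ∃ Q ∈ P, HasGerm (lo Q) (hi Q) x s := by
  have hsmall : ∀ t : ℝ, ∀ᶠ ε in nhdsWithin (0 : ℝ) (Set.Ioi 0), t ≠ 0 → ε < |t| := fun t => by
    by_cases ht : t = 0
    · simp [ht]
    · filter_upwards [Ioo_mem_nhdsGT (abs_pos.2 ht)] with ε hε _ using hε.2
  have hev : ∀ᶠ ε in nhdsWithin (0 : ℝ) (Set.Ioi 0), 0 < ε ∧
      (∀ i, (b i - x i ≠ 0 → ε < |b i - x i|) ∧ (x i - a i ≠ 0 → ε < |x i - a i|)) ∧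
      ∀ Q ∈ P, ∀ i, (lo Q i - x i ≠ 0 → ε < |lo Q i - x i|) ∧
        (hi Q i - x i ≠ 0 → ε < |hi Q i - x i|) := by
    refine (Filter.eventually_mem_set.2 self_mem_nhdsWithin).and (Filter.Eventually.and ?_ ?_)
    · exact Filter.eventually_all.2 fun i => (hsmall _).and (hsmall _)
    · exact (Filter.eventually_all_finite hP.finite).2 fun Q _ =>
        Filter.eventually_all.2 fun i => (hsmall _).and (hsmall _)
  obtain ⟨ε, hε, hR, hQs⟩ := hev.exists
  rw [mem_interior_Icc_pi] at hx
  have hy : (fun i => if s i then x i + ε else x i - ε) ∈ ⋃₀ P := by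
    rw [hP.sUnion_eq]
    constructor <;> intro i <;> have h1 := (hR i).1 <;> have h2 := (hR i).2 <;>
      have h3 := (hx i).1 <;> have h4 := (hx i).2 <;>
      rw [abs_of_pos (by linarith)] at h1 h2 <;> have h1 := h1 (by linarith) <;>
      have h2 := h2 (by linarith) <;> dsimp only <;> split_ifs <;> linarith
  obtain ⟨Q, hQ, hyQ⟩ := hy
  refine ⟨Q, hQ, fun i => ?_⟩
  rw [(hlh Q hQ).2] at hyQ
  have h1 := hyQ.1 i
  have h2 := hyQ.2 i
  obtain ⟨h3, h4⟩ := hQs Q hQ i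
  dsimp only at h1 h2
  split_ifs at h1 h2 ⊢
  · refine ⟨?_, by linarith⟩
    by_contra hc
    rw [abs_of_pos (by linarith)] at h3
    linarith [h3 (by linarith)]
  · refine ⟨by linarith, ?_⟩
    by_contra hc
    rw [abs_of_neg (by linarith)] at h4
    linarith [h4 (by linarith)]

/-- A boundary vector at `x` separates the members on its two sides. -/
theorem isBoundaryVector_iff_germ {R : Set (Fin n → ℝ)} (hP : IsLocallyRegulatedPartition R P)
    (hlh : ∀ Q ∈ P, (∀ i, lo Q i < hi Q i) ∧ Q = Set.Icc (lo Q) (hi Q)) {x : Fin n → ℝ}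
    {G : (Fin n → Bool) → Set (Fin n → ℝ)} (hGP : ∀ s, G s ∈ P)
    (hG : ∀ s, HasGerm (lo (G s)) (hi (G s)) x s) {k : Fin n} :
    IsBoundaryVector P x k ↔ ∃ s, G (Function.update s k true) ≠ G (Function.update s k false) := by
  rw [isBoundaryVector_iff hlh]
  constructor
  · rintro ⟨Q, hQ, hxQ, hk⟩
    rw [(hlh Q hQ).2] at hxQ
    obtain ⟨s, hs⟩ := exists_hasGerm_of_mem (hlh Q hQ).1 hxQ
    refine ⟨s, fun h => ?_⟩
    have h1 := hG (Function.update s k true) k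
    have h2 := hG (Function.update s k false) k
    rw [h] at h1
    simp only [Function.update_self, if_true, Bool.false_eq_true, if_false] at h1 h2
    have hQs : Q = G (Function.update s k false) := by
      refine hP.eq_of_hasGerm hlh hQ (hGP _) hs fun i => ?_
      by_cases hi : i = k
      · subst hi
        split_ifs
        · exact ⟨h1.1, h1.2⟩
        · exact h2
      · have := hG (Function.update s k false) i
        rwa [Function.update_of_ne hi] at this
    rw [← hQs] at h1 h2
    rcases hk with hk | hk <;> linarith
  · rintro ⟨s, hs⟩
    by_contra hc
    push Not at hc
    refine hs (hP.eq_of_hasGerm hlh (hGP _) (hGP _) (s := Function.update s k false) ?_ (hG _))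
    obtain ⟨h1, h2⟩ := hc _ (hGP (Function.update s k true)) (by
      have := (hG (Function.update s k true)).mem
      rwa [← (hlh _ (hGP _)).2] at this)
    intro i
    have := hG (Function.update s k true) i
    by_cases hi : i = k
    · subst hi
      simp only [Function.update_self, if_true, Bool.false_eq_true, if_false] at this ⊢
      exact ⟨lt_of_le_of_ne this.1 (Ne.symm h1), this.2.le⟩
    · rw [Function.update_of_ne hi] at this ⊢
      exact this

/-- In the plane the minimality condition holds at every point which is not a corner of all the
members containing it. -/
theorem partitionNumber_eq_of_not_corner {a b : Fin 2 → ℝ} {P : Set (Set (Fin 2 → ℝ))}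
    (hP : IsLocallyRegulatedPartition (Set.Icc a b) P) {x : Fin 2 → ℝ}
    (hx : x ∈ interior (Set.Icc a b)) {c d : Fin 2 → ℝ} (hcd : ∀ i, c i < d i)
    (hQ : Set.Icc c d ∈ P) (hxQ : x ∈ Set.Icc c d) {i : Fin 2} (hi : c i < x i ∧ x i < d i) :
    partitionNumber P x = boundaryRank P x + 1 := by
  obtain ⟨lo, hi', hlh⟩ := exists_bounds_of_isRectangle hP.isRectangle
  choose G hGP hG using hP.exists_hasGerm hlh hx
  obtain ⟨hc, hd⟩ := Icc_pi_inj hcd (hlh _ hQ).2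
  obtain ⟨j, hji, hj⟩ : ∃ j, j ≠ i ∧ ∀ k, k = i ∨ k = j := by
    fin_cases i
    · exact ⟨1, by decide, by decide⟩
    · exact ⟨0, by decide, by decide⟩
  let σ : Bool → Bool → Fin 2 → Bool := fun u v k => if k = i then u else v
  have hσ : ∀ s, s = σ (s i) (s j) := fun s => by
    funext k; rcases hj k with rfl | rfl <;> simp [σ, hji]
  have hσi : ∀ u v w, Function.update (σ u v) i w = σ w v := fun u v w => by
    funext k; rcases hj k with rfl | rfl <;> simp [σ, hji]
  have hσj : ∀ u v w, Function.update (σ u v) j w = σ u w := fun u v w => by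
    funext k; rcases hj k with rfl | rfl <;> simp [σ, hji, hji.symm]
  have hull : ∀ s s' s'', G s = G s' → (∀ k, s'' k = s k ∨ s'' k = s' k) → G s'' = G s :=
    fun s s' s'' h hs => by
    refine hP.eq_of_hasGerm hlh (hGP _) (hGP _) (hG _) fun k => ?_
    rcases hs k with hk | hk <;> rw [hk]
    · exact hG s k
    · rw [h]; exact hG s' k
  have hN : {Q ∈ P | x ∈ Q} = {G (σ true true), G (σ true false), G (σ false true),
      G (σ false false)} := by
    ext Q
    constructor
    · rintro ⟨hQP, hxQ⟩
      rw [(hlh Q hQP).2] at hxQ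
      obtain ⟨s, hs⟩ := exists_hasGerm_of_mem (hlh Q hQP).1 hxQ
      have := hP.eq_of_hasGerm hlh hQP (hGP s) hs (hG s)
      rw [this, hσ s]
      rcases s i <;> rcases s j <;> simp
    · have hm : ∀ s, G s ∈ {Q ∈ P | x ∈ Q} := fun s => by
        have := (hG s).mem
        rw [← (hlh _ (hGP _)).2] at this
        exact ⟨hGP s, this⟩
      rintro (rfl | rfl | rfl | rfl) <;> exact hm _
  have hbi : IsBoundaryVector P x i ↔ ∃ v, G (σ true v) ≠ G (σ false v) := by
    rw [hP.isBoundaryVector_iff_germ hlh hGP hG]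
    constructor
    · rintro ⟨s, hs⟩
      rw [hσ s, hσi, hσi] at hs
      exact ⟨_, hs⟩
    · rintro ⟨v, hv⟩
      exact ⟨σ true v, by rwa [hσi, hσi]⟩
  have hbj : IsBoundaryVector P x j ↔ ∃ u, G (σ u true) ≠ G (σ u false) := by
    rw [hP.isBoundaryVector_iff_germ hlh hGP hG]
    constructor
    · rintro ⟨s, hs⟩
      rw [hσ s, hσj, hσj] at hs
      exact ⟨_, hs⟩
    · rintro ⟨u, hu⟩
      exact ⟨σ u true, by rwa [hσj, hσj]⟩
  -- The given member is not cut at `x` across axis `i`, so it fills two adjacent quadrants.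
  obtain ⟨v, hv⟩ : ∃ v, G (σ true v) = G (σ false v) := by
    obtain ⟨s, hs⟩ := exists_hasGerm_of_mem hcd hxQ
    have : ∀ u, Set.Icc c d = G (σ u (s j)) := fun u => by
      refine hP.eq_of_hasGerm hlh hQ (hGP _) (s := σ u (s j)) ?_ (hG _)
      rw [← hc, ← hd]
      intro k
      rcases hj k with rfl | rfl
      · split_ifs
        · exact ⟨hi.1.le, hi.2⟩
        · exact ⟨hi.1, hi.2.le⟩
      · have := hs k
        simpa [σ, hji] using this
    exact ⟨s j, (this true).symm.trans (this false)⟩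
  -- If the member `A` filling those two quadrants also fills a third, convexity gives it the
  -- fourth. So the members `A`, `B`, `C` at `x` are all equal, or only `B = C`, or all distinct,
  -- with boundary rank 0, 1, 2 respectively.
  have hA : G (σ true v) = G (σ true (!v)) ∨ G (σ true v) = G (σ false (!v)) →
      G (σ true v) = G (σ true (!v)) ∧ G (σ true v) = G (σ false (!v)) := by
    rintro (h | h)
    · refine ⟨h, hv.trans (hull (σ false v) (σ true (!v)) _ (hv ▸ h) fun k => ?_).symm⟩
      rcases hj k with rfl | rfl <;> simp [σ, hji]
    · refine ⟨(hull (σ true v) (σ false (!v)) _ h fun k => ?_).symm, h⟩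
      rcases hj k with rfl | rfl <;> simp [σ, hji]
  have hw : ∀ w, w = v ∨ w = !v := fun w => by cases v <;> cases w <;> simp
  have hN' : {Q ∈ P | x ∈ Q} = {G (σ true v), G (σ true (!v)), G (σ false (!v))} := by
    rw [hN]
    ext Q
    simp only [Set.mem_insert_iff, Set.mem_singleton_iff]
    cases v
    · rw [← hv]; simp only [Bool.not_false]; tauto
    · rw [← hv]; simp only [Bool.not_true]; tauto
  have hbi' : IsBoundaryVector P x i ↔ G (σ true (!v)) ≠ G (σ false (!v)) := by
    rw [hbi]
    refine ⟨?_, fun h => ⟨_, h⟩⟩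
    rintro ⟨w, h⟩
    rcases hw w with rfl | rfl
    · exact absurd hv h
    · exact h
  have hbj' : IsBoundaryVector P x j ↔
      G (σ true v) ≠ G (σ true (!v)) ∨ G (σ true v) ≠ G (σ false (!v)) := by
    rw [hbj, Bool.exists_bool, hv, or_comm, ← hv]
    nth_rw 2 [hv]
    cases v
    · rw [ne_comm, @ne_comm _ (G (σ false true))]; rfl
    · rfl
  rw [partitionNumber, boundaryRank, hN']
  generalize G (σ true v) = A at *
  generalize G (σ true (!v)) = B at *
  generalize G (σ false (!v)) = C at *
  by_cases hAB : A = B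
  · obtain ⟨rfl, rfl⟩ := hA (Or.inl hAB)
    have : {k | IsBoundaryVector P x k} = ∅ := Set.eq_empty_of_forall_notMem fun k hk => by
      rw [Set.mem_ofPred_eq] at hk
      rcases hj k with rfl | rfl
      · exact hbi'.1 hk rfl
      · simp [hbj'] at hk
    simp [this]
  have hAC : A ≠ C := fun h => hAB (hA (Or.inr h)).1
  by_cases hBC : B = C
  · subst hBC
    have : {k | IsBoundaryVector P x k} = {j} := by
      ext k
      rw [Set.mem_ofPred_eq, Set.mem_singleton_iff]
      rcases hj k with rfl | rfl
      · simp [hbi', hji.symm]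
      · simp [hbj', hAC]
    rw [this, Set.ncard_singleton, Set.pair_eq_singleton, Set.ncard_pair hAC]
  · have : {k | IsBoundaryVector P x k} = {i, j} := by
      ext k
      rw [Set.mem_ofPred_eq]
      rcases hj k with rfl | rfl
      · simp [hbi', hBC]
      · simp [hbj', hAC]
    rw [this, Set.ncard_pair hji.symm, Set.ncard_eq_three]
    exact ⟨A, B, C, hAB, hAC, hBC, rfl⟩

end IsLocallyRegulatedPartition

/-! ### Vertical cuts in the plane and the resulting free cells -/

/-- The horizontal side at height `y` of a cell over `[l, r]` lies on a side of a member of `S` over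
all of `[l, r]`, or at the height `e` of the frame. -/
def IsCellHeight (S : Set (Set (Fin 2 → ℝ))) (lo hi side : Set (Fin 2 → ℝ) → Fin 2 → ℝ)
    (l r e y : ℝ) : Prop :=
  y = e ∨ ∃ Q ∈ S, lo Q 0 ≤ l ∧ r ≤ hi Q 0 ∧ y = side Q 1

/-- `Icc c d` is one of the cells into which the vertical lines with abscissas in `X` and the members
of `S` cut the rest of `Icc a b`. -/
structure IsFreeCell (a b : Fin 2 → ℝ) (S : Set (Set (Fin 2 → ℝ)))
    (lo hi : Set (Fin 2 → ℝ) → Fin 2 → ℝ) (X : Set ℝ) (c d : Fin 2 → ℝ) : Prop where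
  lt : ∀ i, c i < d i
  left_mem : c 0 ∈ X
  right_mem : d 0 ∈ X
  consecutive : ∀ t ∈ X, t ≤ c 0 ∨ d 0 ≤ t
  bottom : IsCellHeight S lo hi hi (c 0) (d 0) (a 1) (c 1)
  top : IsCellHeight S lo hi lo (c 0) (d 0) (b 1) (d 1)
  free : ∀ Q ∈ S, hi Q 0 ≤ c 0 ∨ d 0 ≤ lo Q 0 ∨ hi Q 1 ≤ c 1 ∨ d 1 ≤ lo Q 1

theorem Fin.forall_two_of {p : Fin 2 → Prop} (h0 : p 0) (h1 : p 1) : ∀ i, p i := by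
  intro i; fin_cases i <;> assumption

/-- A point of `[min X, max X]` lies in an interval between consecutive points of `X`, and not at
its right end unless it is `max X`. -/
theorem exists_consecutive_right {X : Set ℝ} (hX : X.Finite) {a b x : ℝ} (ha : a ∈ X) (hb : b ∈ X)
    (hbX : ∀ t ∈ X, t ≤ b) (hab : a < b) (hax : a ≤ x) (hxb : x ≤ b) :
    ∃ l ∈ X, ∃ r ∈ X, l < r ∧ l ≤ x ∧ x ≤ r ∧ (x < b → x < r) ∧ ∀ t ∈ X, t ≤ l ∨ r ≤ t := by
  obtain ⟨l, ⟨hlX, hlx, hlb⟩, hl⟩ := Set.exists_max_image {t ∈ X | t ≤ x ∧ t < b} id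
    (hX.subset fun _ h => h.1) ⟨a, ha, hax, hab⟩
  obtain ⟨r, ⟨hrX, hlr⟩, hr⟩ := Set.exists_min_image {t ∈ X | l < t} id
    (hX.subset fun _ h => h.1) ⟨b, hb, hlb⟩
  have hxr : x < b → x < r := fun hx => by
    by_contra hc
    exact absurd (hl r ⟨hrX, not_lt.1 hc, (not_lt.1 hc).trans_lt hx⟩) (not_le.2 hlr)
  refine ⟨l, hlX, r, hrX, hlr, hlx, ?_, hxr, fun t ht => ?_⟩
  · rcases hxb.lt_or_eq with h | rfl
    · exact (hxr h).le
    · by_contra hc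
      exact absurd (hl r ⟨hrX, (not_le.1 hc).le, not_le.1 hc⟩) (not_le.2 hlr)
  · by_contra! hc
    exact absurd (hr t ⟨ht, hc.1⟩) (not_le.2 hc.2)

theorem exists_consecutive_left {X : Set ℝ} (hX : X.Finite) {a x : ℝ} (ha : a ∈ X)
    (hax : a < x) : ∃ l ∈ X, l < x ∧ ∀ t ∈ X, t ≤ l ∨ x ≤ t := by
  obtain ⟨l, ⟨hlX, hlx⟩, hl⟩ := Set.exists_max_image {t ∈ X | t < x} id
    (hX.subset fun _ h => h.1) ⟨a, ha, hax⟩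
  refine ⟨l, hlX, hlx, fun t ht => ?_⟩
  by_contra! hc
  exact absurd (hl t ⟨ht, hc.2⟩) (not_le.2 hc.1)

section FreeCells

variable {a b : Fin 2 → ℝ} {S : Set (Set (Fin 2 → ℝ))} {lo hi : Set (Fin 2 → ℝ) → Fin 2 → ℝ}
  {X : Set ℝ}

/-- A point of the strip over `[l, r]` outside the members of `S` spanning the strip lies in a free
cell, and off its horizontal sides unless it is on the frame. -/
theorem exists_isFreeCell (hab : ∀ i, a i < b i) (hS : S.Finite)
    (hloX : ∀ Q ∈ S, lo Q 0 ∈ X) (hhiX : ∀ Q ∈ S, hi Q 0 ∈ X)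
    {l r : ℝ} (hl : l ∈ X) (hr : r ∈ X) (hlr : l < r) (hcons : ∀ t ∈ X, t ≤ l ∨ r ≤ t)
    {y : ℝ} (hay : a 1 ≤ y) (hyb : y ≤ b 1)
    (hy : ∀ Q ∈ S, lo Q 0 ≤ l → r ≤ hi Q 0 → y < lo Q 1 ∨ hi Q 1 < y) :
    ∃ c d, IsFreeCell a b S lo hi X c d ∧ c 0 = l ∧ d 0 = r ∧ c 1 ≤ y ∧ y ≤ d 1 ∧
      (a 1 < y → c 1 < y) ∧ (y < b 1 → y < d 1) := by
  let T : Set (Set (Fin 2 → ℝ)) := {Q ∈ S | lo Q 0 ≤ l ∧ r ≤ hi Q 0}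
  have hT : T.Finite := hS.subset fun _ h => h.1
  -- The cell reaches down to the highest top, and up to the lowest bottom, among the members
  -- spanning the strip, or to the frame if there is none.
  obtain ⟨u, hu, humax⟩ := Set.exists_max_image
    (insert (a 1) ((fun Q => hi Q 1) '' {Q ∈ T | hi Q 1 < y})) id
    (((hT.subset fun _ h => h.1).image _).insert _) ⟨_, Set.mem_insert _ _⟩
  obtain ⟨w, hw, hwmin⟩ := Set.exists_min_image
    (insert (b 1) ((fun Q => lo Q 1) '' {Q ∈ T | y < lo Q 1})) id
    (((hT.subset fun _ h => h.1).image _).insert _) ⟨_, Set.mem_insert _ _⟩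
  have huy : u ≤ y ∧ (a 1 < y → u < y) := by
    rcases hu with rfl | ⟨Q, ⟨-, hQ⟩, rfl⟩
    · exact ⟨hay, id⟩
    · exact ⟨hQ.le, fun _ => hQ⟩
  have hyw : y ≤ w ∧ (y < b 1 → y < w) := by
    rcases hw with rfl | ⟨Q, ⟨-, hQ⟩, rfl⟩
    · exact ⟨hyb, id⟩
    · exact ⟨hQ.le, fun _ => hQ⟩
  have huw : u < w := by
    rcases hay.lt_or_eq with h | h
    · exact (huy.2 h).trans_le hyw.1
    · exact huy.1.trans_lt (hyw.2 (h ▸ hab 1))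
  refine ⟨![l, u], ![r, w], ⟨Fin.forall_two_of hlr huw, hl, hr, hcons, ?_, ?_, fun Q hQ => ?_⟩,
    rfl, rfl, huy.1, hyw.1, huy.2, hyw.2⟩
  · rcases hu with rfl | ⟨Q, ⟨hQT, hQ⟩, rfl⟩
    · exact Or.inl rfl
    · exact Or.inr ⟨Q, hQT.1, hQT.2.1, hQT.2.2, rfl⟩
  · rcases hw with rfl | ⟨Q, ⟨hQT, hQ⟩, rfl⟩
    · exact Or.inl rfl
    · exact Or.inr ⟨Q, hQT.1, hQT.2.1, hQT.2.2, rfl⟩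
  · change hi Q 0 ≤ l ∨ r ≤ lo Q 0 ∨ hi Q 1 ≤ u ∨ w ≤ lo Q 1
    rcases hcons _ (hhiX Q hQ) with h1 | h1
    · exact Or.inl h1
    rcases hcons _ (hloX Q hQ) with h2 | h2
    · rcases hy Q hQ h2 h1 with h3 | h3
      · exact Or.inr (Or.inr (Or.inr (hwmin _ (Or.inr ⟨Q, ⟨⟨hQ, h2, h1⟩, h3⟩, rfl⟩))))
      · exact Or.inr (Or.inr (Or.inl (humax _ (Or.inr ⟨Q, ⟨⟨hQ, h2, h1⟩, h3⟩, rfl⟩))))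
    · exact Or.inr (Or.inl h2)

namespace IsFreeCell

/-- A free cell is contained in every free cell with which it shares an interior point. -/
theorem le_of_mem {c d c' d' y : Fin 2 → ℝ} (hlh : ∀ Q ∈ S, ∀ i, lo Q i < hi Q i)
    (hbd : ∀ Q ∈ S, ∀ i, a i ≤ lo Q i ∧ hi Q i ≤ b i)
    (h : IsFreeCell a b S lo hi X c d) (h' : IsFreeCell a b S lo hi X c' d')
    (hy : ∀ i, c i < y i ∧ y i < d i) (hy' : ∀ i, c' i < y i ∧ y i < d' i) :
    (∀ i, c' i ≤ c i) ∧ ∀ i, d i ≤ d' i := by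
  have h0 := hy 0
  have h0' := hy' 0
  have h1 := hy 1
  have h1' := hy' 1
  have e1 : c' 0 ≤ c 0 := (h.consecutive _ h'.left_mem).resolve_right fun hc => by linarith
  have e2 : d 0 ≤ d' 0 := (h.consecutive _ h'.right_mem).resolve_left fun hc => by linarith
  have e3 : c 0 ≤ c' 0 := (h'.consecutive _ h.left_mem).resolve_right fun hc => by linarith
  have e4 : d' 0 ≤ d 0 := (h'.consecutive _ h.right_mem).resolve_left fun hc => by linarith
  have hc0 := h.lt 0
  refine ⟨Fin.forall_two_of e1 ?_, Fin.forall_two_of e2 ?_⟩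
  · rcases h'.bottom with hb | ⟨Q, hQ, hQ1, hQ2, hb⟩
    · rw [hb]
      rcases h.bottom with hb | ⟨Q, hQ, -, -, hb⟩
      · exact hb.ge
      · linarith [hbd Q hQ 1, hlh Q hQ 1]
    · have := hlh Q hQ 1
      rcases h.free Q hQ with hf | hf | hf | hf <;> linarith
  · rcases h'.top with hb | ⟨Q, hQ, hQ1, hQ2, hb⟩
    · rw [hb]
      rcases h.top with hb | ⟨Q, hQ, -, -, hb⟩
      · exact hb.le
      · linarith [hbd Q hQ 1, hlh Q hQ 1]
    · have := hlh Q hQ 1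
      rcases h.free Q hQ with hf | hf | hf | hf <;> linarith

theorem bounds {c d : Fin 2 → ℝ} (hlh : ∀ Q ∈ S, ∀ i, lo Q i < hi Q i)
    (hbd : ∀ Q ∈ S, ∀ i, a i ≤ lo Q i ∧ hi Q i ≤ b i) (hX : ∀ t ∈ X, a 0 ≤ t ∧ t ≤ b 0)
    (h : IsFreeCell a b S lo hi X c d) : a ≤ c ∧ d ≤ b := by
  refine ⟨Fin.forall_two_of (hX _ h.left_mem).1 ?_, Fin.forall_two_of (hX _ h.right_mem).2 ?_⟩
  · rcases h.bottom with hb | ⟨Q, hQ, -, -, hb⟩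
    · exact hb.ge
    · linarith [hbd Q hQ 1, hlh Q hQ 1]
  · rcases h.top with hb | ⟨Q, hQ, -, -, hb⟩
    · exact hb.le
    · linarith [hbd Q hQ 1, hlh Q hQ 1]

theorem finite (hS : S.Finite) (hX : X.Finite) :
    {C | ∃ c d, IsFreeCell a b S lo hi X c d ∧ C = Set.Icc c d}.Finite := by
  let Y : Set ℝ := X ∪ ({a 1, b 1} ∪ ((fun Q => lo Q 1) '' S ∪ (fun Q => hi Q 1) '' S))
  have hY : Y.Finite := hX.union ((Set.toFinite _).union ((hS.image _).union (hS.image _)))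
  have hYpi : (Set.univ.pi fun _ : Fin 2 => Y).Finite := Set.Finite.pi fun _ => hY
  refine (Set.Finite.image2 Set.Icc hYpi hYpi).subset ?_
  rintro C ⟨c, d, h, rfl⟩
  refine ⟨c, fun i _ => ?_, d, fun i _ => ?_, rfl⟩
  · revert i
    refine Fin.forall_two_of (fun _ => Or.inl h.left_mem) fun _ => ?_
    rcases h.bottom with hb | ⟨Q, hQ, -, -, hb⟩
    · simp [Y, hb]
    · exact Or.inr (Or.inr (Or.inr ⟨Q, hQ, hb.symm⟩))
  · revert i
    refine Fin.forall_two_of (fun _ => Or.inl h.right_mem) fun _ => ?_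
    rcases h.top with hb | ⟨Q, hQ, -, -, hb⟩
    · simp [Y, hb]
    · exact Or.inr (Or.inr (Or.inl ⟨Q, hQ, hb.symm⟩))

end IsFreeCell

end FreeCells

/-- Each interior point lies in a member of which it is not a corner. Either it is strictly between
the vertical sides of a given rectangle, or it is strictly between the horizontal sides of a free
cell. The latter covers points on a vertical side of a given rectangle: by disjointness no other one
contains the point, so the strip on the outer side is free there. -/
theorem IsDisjointSubrectangles.exists_minimal_partition {a b : Fin 2 → ℝ} (hab : ∀ i, a i < b i)
    {S : Set (Set (Fin 2 → ℝ))} (hS : IsDisjointSubrectangles (Set.Icc a b) S) :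
    ∃ P, IsMinimalLocallyRegulatedPartition (Set.Icc a b) P ∧ S ⊆ P := by
  obtain ⟨lo, hi, hlh⟩ := exists_bounds_of_isRectangle hS.isRectangle
  have hlt : ∀ Q ∈ S, ∀ i, lo Q i < hi Q i := fun Q hQ => (hlh Q hQ).1
  have hmem : ∀ Q ∈ S, ∀ x, x ∈ Q ↔ ∀ i, lo Q i ≤ x i ∧ x i ≤ hi Q i := fun Q hQ x => by
    conv_lhs => rw [(hlh Q hQ).2]
    exact ⟨fun h i => ⟨h.1 i, h.2 i⟩, fun h => ⟨fun i => (h i).1, fun i => (h i).2⟩⟩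
  have hbd : ∀ Q ∈ S, ∀ i, a i ≤ lo Q i ∧ hi Q i ≤ b i := fun Q hQ i => by
    have hsub := hS.subset Q hQ
    have h1 := hsub ((hmem Q hQ (lo Q)).2 fun i => ⟨le_rfl, (hlt Q hQ i).le⟩)
    have h2 := hsub ((hmem Q hQ (hi Q)).2 fun i => ⟨(hlt Q hQ i).le, le_rfl⟩)
    exact ⟨h1.1 i, h2.2 i⟩
  let X : Set ℝ := {a 0, b 0} ∪ ((fun Q => lo Q 0) '' S ∪ (fun Q => hi Q 0) '' S)
  have hXfin : X.Finite := (Set.toFinite _).union ((hS.finite.image _).union (hS.finite.image _))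
  have haX : a 0 ∈ X := by simp [X]
  have hbX : b 0 ∈ X := by simp [X]
  have hloX : ∀ Q ∈ S, lo Q 0 ∈ X := fun Q hQ => Or.inr (Or.inl ⟨Q, hQ, rfl⟩)
  have hhiX : ∀ Q ∈ S, hi Q 0 ∈ X := fun Q hQ => Or.inr (Or.inr ⟨Q, hQ, rfl⟩)
  have hX : ∀ t ∈ X, a 0 ≤ t ∧ t ≤ b 0 := by
    have := hab 0
    rintro t ((rfl | rfl) | ⟨Q, hQ, rfl⟩ | ⟨Q, hQ, rfl⟩)
    · exact ⟨le_rfl, this.le⟩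
    · exact ⟨this.le, le_rfl⟩
    · exact ⟨(hbd Q hQ 0).1, (hlt Q hQ 0).le.trans (hbd Q hQ 0).2⟩
    · exact ⟨(hbd Q hQ 0).1.trans (hlt Q hQ 0).le, (hbd Q hQ 0).2⟩
  let F : Set (Set (Fin 2 → ℝ)) := {C | ∃ c d, IsFreeCell a b S lo hi X c d ∧ C = Set.Icc c d}
  have hoff : ∀ x : Fin 2 → ℝ, ∀ l r : ℝ, l ≤ x 0 → x 0 ≤ r →
      (∀ Q ∈ S, x ∈ Q → l < lo Q 0 ∨ hi Q 0 < r) →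
      ∀ Q ∈ S, lo Q 0 ≤ l → r ≤ hi Q 0 → x 1 < lo Q 1 ∨ hi Q 1 < x 1 := by
    intro x l r hl hr hx Q hQ h1 h2
    by_contra! hc
    have := hx Q hQ ((hmem Q hQ x).2 (Fin.forall_two_of ⟨h1.trans hl, hr.trans h2⟩ hc))
    rcases this with h | h <;> linarith
  have hSF : ∀ Q ∈ S, ∀ C ∈ F, interior Q ∩ interior C = ∅ := by
    rintro Q hQ C ⟨c, d, hcd, rfl⟩
    refine Set.eq_empty_of_forall_notMem fun y hy => ?_
    rw [(hlh Q hQ).2] at hy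
    have h1 := mem_interior_Icc_pi.1 hy.1
    have h2 := mem_interior_Icc_pi.1 hy.2
    rcases hcd.free Q hQ with h | h | h | h
    · linarith [h1 0, h2 0]
    · linarith [h1 0, h2 0]
    · linarith [h1 1, h2 1]
    · linarith [h1 1, h2 1]
  have hpart : IsLocallyRegulatedPartition (Set.Icc a b) (S ∪ F) := by
    refine ⟨hS.finite.union (IsFreeCell.finite hS.finite hXfin), ?_, ?_, ?_⟩
    · rintro Q (hQ | ⟨c, d, h, rfl⟩)
      · exact hS.isRectangle Q hQ
      · exact ⟨c, d, h.lt, rfl⟩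
    · refine Set.Subset.antisymm (Set.sUnion_subset ?_) fun x hx => ?_
      · rintro Q (hQ | ⟨c, d, h, rfl⟩)
        · exact hS.subset Q hQ
        · have := h.bounds hlt hbd hX
          exact Set.Icc_subset_Icc this.1 this.2
      by_cases hxS : ∃ Q ∈ S, x ∈ Q
      · obtain ⟨Q, hQ, hxQ⟩ := hxS
        exact ⟨Q, Or.inl hQ, hxQ⟩
      obtain ⟨l, hl, r, hr, hlr, hlx, hxr, -, hcons⟩ := exists_consecutive_right hXfin haX hbX
        (fun t ht => (hX t ht).2) (hab 0) (hx.1 0) (hx.2 0)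
      obtain ⟨c, d, hcd, rfl, rfl, h1, h2, -⟩ := exists_isFreeCell hab hS.finite hloX hhiX hl hr
        hlr hcons (hx.1 1) (hx.2 1) (hoff x l r hlx hxr fun Q hQ hxQ => absurd ⟨Q, hQ, hxQ⟩ hxS)
      exact ⟨_, Or.inr ⟨c, d, hcd, rfl⟩, Fin.forall_two_of hlx h1, Fin.forall_two_of hxr h2⟩
    · rintro Q (hQ | hQ) Q' (hQ' | hQ') hne
      · exact Set.subset_eq_empty (Set.inter_subset_inter interior_subset interior_subset)
          (hS.disjoint Q hQ Q' hQ' hne)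
      · exact hSF Q hQ Q' hQ'
      · rw [Set.inter_comm]; exact hSF Q' hQ' Q hQ
      · obtain ⟨c, d, h, rfl⟩ := hQ
        obtain ⟨c', d', h', rfl⟩ := hQ'
        refine Set.eq_empty_of_forall_notMem fun y hy => hne ?_
        have h1 := mem_interior_Icc_pi.1 hy.1
        have h2 := mem_interior_Icc_pi.1 hy.2
        have h3 := h.le_of_mem hlt hbd h' h1 h2
        have h4 := h'.le_of_mem hlt hbd h h2 h1
        exact congrArg₂ Set.Icc (le_antisymm h4.1 h3.1) (le_antisymm h3.2 h4.2)
  refine ⟨S ∪ F, ⟨hpart, fun x hx => ?_⟩, Set.subset_union_left⟩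
  have hxab := mem_interior_Icc_pi.1 hx
  have hcell : ∀ l ∈ X, ∀ r ∈ X, l < r → (∀ t ∈ X, t ≤ l ∨ r ≤ t) → l ≤ x 0 → x 0 ≤ r →
      (∀ Q ∈ S, x ∈ Q → l < lo Q 0 ∨ hi Q 0 < r) →
      partitionNumber (S ∪ F) x = boundaryRank (S ∪ F) x + 1 := by
    intro l hl r hr hlr hcons hlx hxr hQ
    obtain ⟨c, d, hcd, rfl, rfl, h1, h2, h3, h4⟩ := exists_isFreeCell hab hS.finite hloX hhiX hl
      hr hlr hcons (hxab 1).1.le (hxab 1).2.le (hoff x l r hlx hxr hQ)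
    exact hpart.partitionNumber_eq_of_not_corner hx hcd.lt (Or.inr ⟨c, d, hcd, rfl⟩)
      ⟨Fin.forall_two_of hlx h1, Fin.forall_two_of hxr h2⟩ ⟨h3 (hxab 1).1, h4 (hxab 1).2⟩
  obtain ⟨l, hl, r, hr, hlr, hlx, hxr, hxr', hcons⟩ := exists_consecutive_right hXfin haX hbX
    (fun t ht => (hX t ht).2) (hab 0) (hxab 0).1.le (hxab 0).2.le
  by_cases hxS : ∃ Q ∈ S, x ∈ Q
  · obtain ⟨Q, hQ, hxQ⟩ := hxS
    have honly : ∀ Q' ∈ S, x ∈ Q' → Q' = Q := fun Q' hQ' hx' => by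
      by_contra hne
      exact Set.eq_empty_iff_forall_notMem.1 (hS.disjoint Q' hQ' Q hQ hne) x ⟨hx', hxQ⟩
    have hx0 := (hmem Q hQ x).1 hxQ 0
    rcases hx0.2.lt_or_eq with hlt2 | heq
    · rcases hx0.1.lt_or_eq with hlt1 | heq
      · have hQP : Set.Icc (lo Q) (hi Q) ∈ S ∪ F := by rw [← (hlh Q hQ).2]; exact Or.inl hQ
        refine hpart.partitionNumber_eq_of_not_corner hx (hlt Q hQ) hQP ?_ ⟨hlt1, hlt2⟩
        rwa [← (hlh Q hQ).2]
      -- On the left side of `Q` the strip ending at `x 0` is used, whereas the right side is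
      -- handled by the strip starting there.
      · obtain ⟨l', hl', hlx', hcons'⟩ := exists_consecutive_left hXfin haX (hxab 0).1
        exact hcell l' hl' (x 0) (heq ▸ hloX Q hQ) hlx' hcons' hlx'.le le_rfl fun Q' hQ' hx' =>
          Or.inl (by rw [honly Q' hQ' hx', heq]; exact hlx')
    · exact hcell l hl r hr hlr hcons hlx hxr fun Q' hQ' hx' =>
        Or.inr (by rw [honly Q' hQ' hx', ← heq]; exact hxr' (hxab 0).2)
  · exact hcell l hl r hr hlr hcons hlx hxr fun Q hQ hxQ => absurd ⟨Q, hQ, hxQ⟩ hxS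

theorem theorem1p3 :
    (∀ R : Set (Fin 2 → ℝ), IsRectangle R →
      ∀ S : Set (Set (Fin 2 → ℝ)), IsDisjointSubrectangles R S →
        ∃ P : Set (Set (Fin 2 → ℝ)), IsMinimalLocallyRegulatedPartition R P ∧ S ⊆ P) ∧
    (∀ n : ℕ, 3 ≤ n → ∀ R : Set (Fin n → ℝ), IsRectangle R →
      ∃ S : Set (Set (Fin n → ℝ)), IsDisjointSubrectangles R S ∧
        ¬ ∃ P : Set (Set (Fin n → ℝ)), IsMinimalLocallyRegulatedPartition R P ∧ S ⊆ P) ∧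
    (IsRectangle cubeR ∧ IsDisjointSubrectangles cubeR cubeBlocks ∧
      ¬ ∃ P : Set (Set (Fin 3 → ℝ)), IsMinimalLocallyRegulatedPartition cubeR P ∧
        cubeBlocks ⊆ P) := by
  refine ⟨?_, fun n hn R hR => ?_, ?_⟩
  · rintro R ⟨a, b, hab, rfl⟩ S hS
    exact hS.exists_minimal_partition hab
  · obtain ⟨a, b, hab, rfl⟩ := hR
    exact ⟨gridBlocks a b, gridBlocks_isDisjointSubrectangles hn hab, gridBlocks_not_subset hn hab⟩
  · rw [cubeBlocks_eq, cubeR_eq]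
    have h04 : ∀ _ : Fin 3, (0 : ℝ) < 4 := fun _ => by norm_num
    exact ⟨⟨_, _, h04, rfl⟩, gridBlocks_isDisjointSubrectangles le_rfl h04,
      gridBlocks_not_subset le_rfl h04⟩
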